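/- **Theorem (utility of SparseProject).** *Setting.* Let $X$ be a finite universe, enumerated as $\{1,\dots,|X|\}$. A database of size $n$ is a multiset $D$ of $n$ elements of $X$, with multiplicities $D[x]$. A linear query is a map $Q:X\to[0,1]$, with value $Q(D)=\frac1n\sum_{x\in D}Q(x)$; it is $m$-sparse if $|\{x:Q(x)>0\}|\le m$. *Mechanism.* Let $n,m,k\ge 1$ be integers and $0<\epsilon,\delta,\beta<1$. Put $$\tau=\frac{\beta}{4k},\qquad T=\Big\lceil 4\cdot 64^2\,\log_2\tfrac1\tau\,\Big(\tfrac{m^{3/2}}{2}+\tfrac{n^4}{2\sqrt m}+\sqrt m\,n^2\Big)\Big\rceil,\qquad \sigma=\frac{\epsilon}{\sqrt{8\ln(1/\delta)}},\qquad r=\Big\lceil 2\log_2\tfrac{kT}{2\beta}\Big\rceil .$$ On a database $D$ of size $n$, SparseProject draws a hash function $f$ from an arbitrary family of $r$-wise independent (unbiased) hash functions $\{1,\dots,T|X|\}\to\{1/\sqrt T,-1/\sqrt T\}$, puts $A[i,x]=f(|X|(i-1)+x)$ and $u_i=\sum_x D[x]A[i,x]$ for $1\le i\le T$, draws independent Laplace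 variables $\nu_1,\dots,\nu_T$ of scale $1/\sigma$ (independent of $f$), and outputs $(u+\nu,f)$. A query $Q$ is evaluated on an output $(\hat u,f)$ by $\mathrm{Eval}(Q,(\hat u,f))=\frac1n\sum_{i=1}^T\hat Q[i]\,\hat u_i$, where $\hat Q[i]=\sum_{x:Q(x)>0}Q(x)A[i,x]$. *Claim.* There is an absolute constant $C>0$ such that for all such $X,n,m,k,\epsilon,\delta,\beta$, every such hash family, and every class $\mathcal Q$ of at most $k$ $m$-sparse linear queries on $X$, SparseProject is $(\alpha,\beta)$-accurate for $\mathcal Q$ with $$\alpha=C\,\log(m+n)\cdot\max\{1,\log(k/\beta)\}\cdot\frac{\sqrt{m\,\max\{1,\log(1/\delta)\}}}{\epsilon n},$$ and the evaluation function above witnesses this; that is, for every database $D$ of size $n$, with probability at least $1-\beta$ over the output $d$ of SparseProject on $D$, $|Q(D)-\mathrm{Eval}(Q,d)|\le\alpha$ for all $Q\in\mathcal Q$. For $\delta\le 1/e$ and $\beta\le k/e$ this reads $\alpha=C\,\log(m+n)\,\log(k/\beta)\sqrt{m\log(1/\delta)}/(\epsilon n)$. The bound does not depend on $|X|$. -/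

import Mathlib

open MeasureTheory

noncomputable section

namespace SparseProj

/-- A linear query on the universe `X`: a map `X → [0,1]`. -/
abbrev LinearQuery (X : Type*) := X → unitInterval

/-- `Q` is `m`-sparse: it is positive on at most `m` elements of the (finite) universe. -/
def IsSparse {X : Type*} [Fintype X] (m : ℕ) (Q : LinearQuery X) : Prop :=
  {x : X | 0 < (Q x : ℝ)}.ncard ≤ m

/-- The value `Q(D) = (1/n) ∑_{x ∈ D} Q(x)` of a linear query on a database of size `n`.
Databases of size `n` are multisets of cardinality `n`, i.e. elements of `Sym X n`. -/
def queryValue {X : Type*} {n : ℕ} (Q : LinearQuery X) (D : Sym X n) : ℝ :=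
  (1 / n) * ((D : Multiset X).map fun x => (Q x : ℝ)).sum

/-- The number `D[x]` of occurrences of `x` in the database `D`. -/
def occ {X : Type*} {n : ℕ} (D : Sym X n) (x : X) : ℕ :=
  open Classical in (D : Multiset X).count x

/-- A (randomized, non-interactive) mechanism on databases of size `n` with outputs in `R`,
given by its output law on each database. -/
abbrev Mechanism (X : Type*) (n : ℕ) (R : Type*) [MeasurableSpace R] := Sym X n → Measure R

/-- `M` is `(α, β)`-accurate for the class `𝒬`, as witnessed by the evaluation function `Eval`:
for every database, with probability at least `1 - β` over the output `r`,
`|Q(D) - Eval Q r| ≤ α` for all `Q ∈ 𝒬` simultaneously. -/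
def IsAccurateWith {X : Type*} {n : ℕ} {R : Type*} [MeasurableSpace R]
    (Eval : LinearQuery X → R → ℝ) (M : Mechanism X n R) (𝒬 : Set (LinearQuery X))
    (α β : ℝ) : Prop :=
  ∀ D : Sym X n,
    ENNReal.ofReal (1 - β) ≤ M D {r | ∀ Q ∈ 𝒬, |queryValue Q D - Eval Q r| ≤ α}

/-- `M` is `(α, β)`-accurate for `𝒬`: some evaluation function witnesses it. -/
def IsAccurate {X : Type*} {n : ℕ} {R : Type*} [MeasurableSpace R]
    (M : Mechanism X n R) (𝒬 : Set (LinearQuery X)) (α β : ℝ) : Prop :=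
  ∃ Eval : LinearQuery X → R → ℝ, IsAccurateWith Eval M 𝒬 α β

/-- The Laplace distribution with scale `b`, of density `(1 / 2b) exp (-|x| / b)`. -/
def laplace (b : ℝ) : Measure ℝ :=
  volume.withDensity fun x => ENNReal.ofReal (1 / (2 * b) * Real.exp (-|x| / b))

/-- The two possible hash values `1/√T` and `-1/√T`. -/
def hashRange (T : ℕ) : Set ℝ := {1 / √(T : ℝ), -(1 / √(T : ℝ))}

/-- Hash functions `[T · N] → {1/√T, -1/√T}`. -/
abbrev HashFn (T N : ℕ) := Fin (T * N) → hashRange T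

/-- A random hash function (of law `H`) is drawn from an `r`-wise independent (unbiased) family:
the values at any at most `r` distinct points are independent and uniform on the two values. -/
def IsWiseIndependent {T N : ℕ} (r : ℕ) (H : PMF (HashFn T N)) : Prop :=
  ∀ S : Finset (Fin (T * N)), S.card ≤ r → ∀ v : HashFn T N,
    H.toMeasure {f | ∀ j ∈ S, f j = v j} = (1 / 2) ^ S.card

/-- The entry `A[i, x]` of the `T × |X|` matrix represented by `f`: with zero-based indices and
`x` the `j`-th element of the universe (in the enumeration `e`) it is `f (|X| · i + j)`. -/
def projEntry {X : Type*} [Fintype X] (e : X ≃ Fin (Fintype.card X)) {T : ℕ}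
    (f : HashFn T (Fintype.card X)) (i : Fin T) (x : X) : ℝ :=
  (f (finProdFinEquiv (i, e x)) : ℝ)

/-- The random projection data structure `(u, f)` of size `T` over a universe of `N` elements. -/
abbrev ProjData (T N : ℕ) := (Fin T → ℝ) × HashFn T N

/-- The projected query `Q̂[i] = ∑_{x : Q(x) > 0} Q[x] · A[i, x]`. -/
def projQuery {X : Type*} [Fintype X] (e : X ≃ Fin (Fintype.card X)) {T : ℕ}
    (f : HashFn T (Fintype.card X)) (Q : LinearQuery X) (i : Fin T) : ℝ :=
  open Classical in
  ∑ x ∈ Finset.univ.filter (fun x => 0 < (Q x : ℝ)), (Q x : ℝ) * projEntry e f i x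

/-- The projected database `u_i = ∑_{x : D[x] > 0} D[x] · A[i, x]`. -/
def projDatabase {X : Type*} [Fintype X] (e : X ≃ Fin (Fintype.card X)) {T n : ℕ}
    (f : HashFn T (Fintype.card X)) (D : Sym X n) (i : Fin T) : ℝ :=
  ∑ x ∈ Finset.univ.filter (fun x => 0 < occ D x), (occ D x : ℝ) * projEntry e f i x

/-- Evaluation of a query on the data structure `(u, f)`: `(1/n) ⟨Q̂, u⟩`. -/
def evalQuery {X : Type*} [Fintype X] (e : X ≃ Fin (Fintype.card X)) {T : ℕ} (n : ℕ)
    (Q : LinearQuery X) (d : ProjData T (Fintype.card X)) : ℝ :=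
  (1 / n) * ∑ i : Fin T, projQuery e d.2 Q i * d.1 i

/-- The parameter `τ = β / (4k)`. -/
def tau (β : ℝ) (k : ℕ) : ℝ := β / (4 * k)

/-- The dimension `T = 4·64²·log₂(1/τ)·(m^{3/2}/2 + n⁴/(2√m) + √m n²)`, rounded up. -/
def projDim (n : ℕ) (β : ℝ) (m k : ℕ) : ℕ :=
  ⌈4 * 64 ^ 2 * Real.logb 2 (1 / tau β k) *
    ((m : ℝ) ^ (3 / 2 : ℝ) / 2 + (n : ℝ) ^ 4 / (2 * √(m : ℝ)) + √(m : ℝ) * (n : ℝ) ^ 2)⌉₊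

/-- The degree of independence `2 log₂(kT / (2β))` of the hash family, rounded up. -/
def indepDegree (T : ℕ) (β : ℝ) (k : ℕ) : ℕ :=
  ⌈2 * Real.logb 2 (k * T / (2 * β))⌉₊

/-- The parameter `σ = ε / √(8 ln(1/δ))`. -/
def sigma (ε δ : ℝ) : ℝ := ε / √(8 * Real.log (1 / δ))

/-- SparseProject: draw `f` from the hash family (of law `H`) and, independently, a vector `ν` of
`T` independent `Lap(1/σ)` variables; output `(u + ν, f)`, with `u` the projected database. -/
def sparseProject {X : Type*} [Fintype X] (e : X ≃ Fin (Fintype.card X)) (n : ℕ)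
    (ε δ β : ℝ) (m k : ℕ) (H : PMF (HashFn (projDim n β m k) (Fintype.card X))) :
    Mechanism X n (ProjData (projDim n β m k) (Fintype.card X)) :=
  fun D =>
    (H.toMeasure.prod (Measure.pi fun _ : Fin (projDim n β m k) => laplace (1 / sigma ε δ))).map
      fun p => (fun i => projDatabase e p.1 D i + p.2 i, p.1)

/-- The error bound, with hidden constant `C` and hidden logarithmic factor `log (m + n)`. -/
def errorBound (C : ℝ) (n : ℕ) (ε δ β : ℝ) (m k : ℕ) : ℝ :=
  C * Real.log (m + n) *
    (max 1 (Real.log (k / β)) * √(m * max 1 (Real.log (1 / δ))) / (ε * n))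

end SparseProj

end

namespace SparseProj

open scoped BigOperators

/-! For one query, let q be its vector of values and d the vector of multiplicities. Up to sign, the
error is (1/n)(⟨Aq, Ad⟩ - ⟨q, d⟩ + ⟨Aq, ν⟩). Only the norms ‖q‖² ≤ m and ‖d‖ ≤ n enter, so the size
of the universe plays no role.

Let p = `momentOrder β k`, roughly log₂(16k/β). Three bad events have to be excluded: the projection
distorts ⟨q, d⟩ by at least 2p·m^(1/4) (`measure_inner_sub_ge_le`); ‖Aq‖² is at least 16m
(`measure_norm_sq_ge_le`); or, with ‖Aq‖² ≤ 16m, the Laplace combination ⟨Aq, ν⟩ is at least 8p√m/σ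
(`measure_le_abs_sum_laplace_le`). Each has probability O(2^(-p)), in total at most β/k, and a union
bound over the queries finishes.

The hash values are only r-wise independent, so exponential moments under `H` are not available
directly. The p-th power of a quadratic form in the hash values has degree 2p ≤ r, however, so its
mean is the same as for uniform independent signs (`integral_eq_expect_of_mem_lowDegree`). There the
rows of A are independent, exponential moments factor over rows, and they control the p-th moment;
Markov's inequality is then applied under `H` (`measure_abs_ge_le`). The estimates for a single row
are `expect_exp_mul_radSum_sq_le` and `expect_exp_radSum_mul_le`. -/

/-- The sign `±1` encoded by a Boolean. -/
def boolSign (b : Bool) : ℝ := if b then 1 else -1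

lemma boolSign_sq (b : Bool) : boolSign b ^ 2 = 1 := by cases b <;> simp [boolSign]

lemma boolSign_not (b : Bool) : boolSign (!b) = -boolSign b := by cases b <;> simp [boolSign]

/-! ### Exponential moments of Rademacher sums and their products -/

section Rademacher

variable {X : Type*}

/-- The Rademacher sum `∑ x, a x * s x` of the signs `b`. -/
def radSum [Fintype X] (a : X → ℝ) (b : X → Bool) : ℝ := ∑ x, a x * boolSign (b x)

variable [DecidableEq X]

/-- Negate the sign at `x`. -/
def flipAt (x : X) (b : X → Bool) : X → Bool := Function.update b x (!b x)

lemma flipAt_same (x : X) (b : X → Bool) : flipAt x b x = !b x := by simp [flipAt]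

lemma flipAt_of_ne {x y : X} (h : y ≠ x) (b : X → Bool) : flipAt x b y = b y := by
  simp [flipAt, h]

lemma flipAt_involutive (x : X) : Function.Involutive (flipAt x) := by
  intro b
  ext y
  by_cases h : y = x
  · subst h; simp [flipAt_same]
  · simp [flipAt_of_ne h]

variable [Fintype X]

lemma expect_flipAt (x : X) (F : (X → Bool) → ℝ) : 𝔼 b, F (flipAt x b) = 𝔼 b, F b :=
  Fintype.expect_equiv (flipAt_involutive x).toPerm _ _ fun _ => rfl

/-- Averaging over the sign at `x` first. -/
lemma expect_eq_expect_half_add_flipAt (x : X) (F : (X → Bool) → ℝ) :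
    𝔼 b, F b = 𝔼 b, (F b + F (flipAt x b)) / 2 := by
  rw [← Finset.expect_div, Finset.expect_add_distrib, expect_flipAt]
  ring

lemma expect_boolSign_mul_boolSign (x y : X) :
    𝔼 b : X → Bool, boolSign (b x) * boolSign (b y) = if x = y then 1 else 0 := by
  split_ifs with h
  · subst h
    simp [← sq, boolSign_sq]
  · rw [expect_eq_expect_half_add_flipAt x]
    refine Finset.expect_eq_zero fun b _ => ?_
    rw [flipAt_same, flipAt_of_ne (Ne.symm h), boolSign_not]
    ring

lemma expect_radSum_mul_radSum (a c : X → ℝ) :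
    𝔼 b : X → Bool, radSum a b * radSum c b = ∑ x, a x * c x := by
  have h : ∀ b : X → Bool, radSum a b * radSum c b =
      ∑ x, ∑ y, a x * c y * (boolSign (b x) * boolSign (b y)) := by
    intro b
    rw [radSum, radSum, Finset.sum_mul_sum]
    exact Finset.sum_congr rfl fun x _ => Finset.sum_congr rfl fun y _ => by ring
  simp_rw [h, Finset.expect_sum_comm, ← Finset.mul_expect, expect_boolSign_mul_boolSign]
  simp

/-- Expanding the squares leaves the cross term cosh(2Aca), which is at most exp(2A²c²a²). Averaging
out one sign thus only raises the coefficient of c². -/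
lemma half_exp_sq_add_exp_sq_le (A c a : ℝ) :
    (Real.exp (A * (c + a) ^ 2) + Real.exp (A * (c - a) ^ 2)) / 2 ≤
      Real.exp (A * a ^ 2) * Real.exp ((A + 2 * A ^ 2 * a ^ 2) * c ^ 2) := by
  have h1 : Real.exp (A * (c + a) ^ 2) =
      Real.exp (A * (c ^ 2 + a ^ 2)) * Real.exp (2 * A * c * a) := by
    rw [← Real.exp_add]; ring_nf
  have h2 : Real.exp (A * (c - a) ^ 2) =
      Real.exp (A * (c ^ 2 + a ^ 2)) * Real.exp (-(2 * A * c * a)) := by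
    rw [← Real.exp_add]; ring_nf
  have h3 := Real.cosh_le_exp_half_sq (2 * A * c * a)
  rw [h1, h2, ← mul_add, mul_div_assoc, ← Real.cosh_eq]
  calc _ ≤ Real.exp (A * (c ^ 2 + a ^ 2)) * Real.exp ((2 * A * c * a) ^ 2 / 2) := by gcongr
    _ = _ := by rw [← Real.exp_add, ← Real.exp_add]; ring_nf

/-- Coordinates are averaged out one at a time, each replacing A by A + 2A²a_x². The budget
inequality keeps A ≤ 2μ, so each increment is at most 8μ²a_x² and the inequality survives. Since A
changes, it is quantified inside the induction. -/
lemma expect_exp_mul_sq_sum_le (a : X → ℝ) {μ : ℝ} (s : Finset X) :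
    ∀ A : ℝ, 0 ≤ A → A + 8 * μ ^ 2 * ∑ x ∈ s, a x ^ 2 ≤ 2 * μ →
      𝔼 b : X → Bool, Real.exp (A * (∑ x ∈ s, a x * boolSign (b x)) ^ 2) ≤
        Real.exp (2 * μ * ∑ x ∈ s, a x ^ 2) := by
  induction s using Finset.induction_on with
  | empty => intro A _ _; simp
  | insert x s hx ih =>
    intro A hA h
    rw [Finset.sum_insert hx] at h ⊢
    have hs : 0 ≤ ∑ y ∈ s, a y ^ 2 := Finset.sum_nonneg fun _ _ => sq_nonneg _
    have hA2 : A ≤ 2 * μ := by nlinarith [sq_nonneg μ, sq_nonneg (a x)]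
    have hA4 : A ^ 2 ≤ 4 * μ ^ 2 := by nlinarith
    rw [expect_eq_expect_half_add_flipAt x]
    have step : ∀ b : X → Bool,
        (Real.exp (A * (∑ y ∈ insert x s, a y * boolSign (b y)) ^ 2) +
          Real.exp (A * (∑ y ∈ insert x s, a y * boolSign (flipAt x b y)) ^ 2)) / 2 ≤
        Real.exp (A * a x ^ 2) *
          Real.exp ((A + 2 * A ^ 2 * a x ^ 2) * (∑ y ∈ s, a y * boolSign (b y)) ^ 2) := by
      intro b
      have e1 : ∑ y ∈ s, a y * boolSign (flipAt x b y) = ∑ y ∈ s, a y * boolSign (b y) :=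
        Finset.sum_congr rfl fun y hy => by
          rw [flipAt_of_ne]; rintro rfl; exact hx hy
      rw [Finset.sum_insert hx, Finset.sum_insert hx, e1, flipAt_same, boolSign_not]
      have := half_exp_sq_add_exp_sq_le A (∑ y ∈ s, a y * boolSign (b y)) (a x * boolSign (b x))
      rw [mul_pow, boolSign_sq, mul_one] at this
      convert this using 6 <;> ring
    refine (Finset.expect_le_expect fun b _ => step b).trans ?_
    rw [← Finset.mul_expect, mul_add, Real.exp_add]
    refine mul_le_mul ?_ (ih _ (by positivity) ?_) ?_ (Real.exp_nonneg _)
    · exact Real.exp_le_exp.2 (by gcongr)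
    · nlinarith [mul_le_mul_of_nonneg_right hA4 (sq_nonneg (a x))]
    · exact Finset.expect_nonneg fun _ _ => Real.exp_nonneg _

/-- The exponential moment of the square of a Rademacher sum. -/
lemma expect_exp_mul_radSum_sq_le {a : X → ℝ} (ha : ∑ x, a x ^ 2 ≤ 1) {μ : ℝ} (h0 : 0 ≤ μ)
    (h1 : μ ≤ 1 / 8) :
    𝔼 b, Real.exp (μ * radSum a b ^ 2) ≤ Real.exp (2 * μ) := by
  have hs : 0 ≤ ∑ y, a y ^ 2 := Finset.sum_nonneg fun _ _ => sq_nonneg _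
  -- Starting from A = μ the budget holds because 8μ² ≤ μ.
  refine (expect_exp_mul_sq_sum_le a (μ := μ) Finset.univ μ h0 ?_).trans
    (Real.exp_le_exp.2 (by nlinarith))
  nlinarith [mul_le_mul_of_nonneg_left ha (sq_nonneg μ)]

/-- The quadratic term of the exponential series at w/16 gives w² ≤ 512 exp(w/16). -/
lemma sq_mul_exp_le {w : ℝ} (hw : 0 ≤ w) :
    w ^ 2 * Real.exp (w / 16) ≤ 512 * Real.exp (w / 8) := by
  have h := Real.pow_div_factorial_le_exp (w / 16) (by positivity) 2
  have h2 : Real.exp (w / 8) = Real.exp (w / 16) * Real.exp (w / 16) := by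
    rw [← Real.exp_add]; ring_nf
  rw [h2]
  norm_num [Nat.factorial] at h
  nlinarith [Real.exp_pos (w / 16)]

lemma exp_le_one_add_add_sq_mul_exp (x : ℝ) :
    Real.exp x ≤ 1 + x + |x| ^ 2 * Real.exp |x| := by
  have h := Complex.norm_exp_sub_sum_le_norm_mul_exp (x : ℂ) 2
  have e : Complex.exp x - ∑ j ∈ Finset.range 2, (x : ℂ) ^ j / (j.factorial : ℂ) =
      ((Real.exp x - (1 + x) : ℝ) : ℂ) := by
    simp [Finset.sum_range_succ]
  rw [e, Complex.norm_real, Complex.norm_real, Real.norm_eq_abs, Real.norm_eq_abs] at h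
  linarith [le_abs_self (Real.exp x - (1 + x))]

/-- The exponential moment of a centred product of two Rademacher sums. -/
lemma expect_exp_radSum_mul_le {a c : X → ℝ} (ha : ∑ x, a x ^ 2 ≤ 1) (hc : ∑ x, c x ^ 2 ≤ 1)
    {l : ℝ} (hl : |l| ≤ 1 / 16) :
    𝔼 b, Real.exp (l * (radSum a b * radSum c b - ∑ x, a x * c x)) ≤
      Real.exp (1024 * l ^ 2) := by
  set d := ∑ x, a x * c x
  have hd : |d| ≤ 1 := by
    refine (Finset.abs_sum_le_sum_abs _ _).trans ?_
    calc ∑ x, |a x * c x| ≤ ∑ x, (a x ^ 2 + c x ^ 2) / 2 := by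
          refine Finset.sum_le_sum fun x _ => ?_
          rw [abs_mul, ← sq_abs (a x), ← sq_abs (c x)]
          nlinarith [sq_nonneg (|a x| - |c x|)]
      _ ≤ 1 := by rw [← Finset.sum_div, Finset.sum_add_distrib]; linarith
  set W : (X → Bool) → ℝ := fun b => radSum a b * radSum c b - d
  have hW0 : 𝔼 b, W b = 0 := by
    simp only [W]
    rw [Finset.expect_sub_distrib, expect_radSum_mul_radSum, Fintype.expect_const]
    exact sub_self _
  have hWabs : ∀ b, |W b| ≤ (radSum a b ^ 2 + radSum c b ^ 2) / 2 + 1 := by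
    intro b
    refine (abs_sub _ _).trans (add_le_add ?_ hd)
    rw [abs_mul, ← sq_abs (radSum a b), ← sq_abs (radSum c b)]
    nlinarith [sq_nonneg (|radSum a b| - |radSum c b|)]
  -- AM-GM splits the product of the two exponentials, so each square is needed only at μ = 1/8, the
  -- largest admissible value.
  have hexpW : 𝔼 b, Real.exp (|W b| / 8) ≤ 2 := by
    calc 𝔼 b, Real.exp (|W b| / 8) ≤ 𝔼 b, Real.exp (1 / 8) *
          ((Real.exp (1 / 8 * radSum a b ^ 2) + Real.exp (1 / 8 * radSum c b ^ 2)) / 2) := by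
          refine Finset.expect_le_expect fun b _ => ?_
          have h1 : Real.exp (|W b| / 8) ≤ Real.exp (1 / 8) *
              (Real.exp (1 / 16 * radSum a b ^ 2) * Real.exp (1 / 16 * radSum c b ^ 2)) := by
            rw [← Real.exp_add, ← Real.exp_add]
            exact Real.exp_le_exp.2 (by linarith [hWabs b])
          refine h1.trans (mul_le_mul_of_nonneg_left ?_ (Real.exp_nonneg _))
          have e : ∀ t : ℝ, Real.exp (1 / 8 * t) = Real.exp (1 / 16 * t) ^ 2 := by
            intro t; rw [← Real.exp_nat_mul]; congr 1; push_cast; ring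
          rw [e, e]
          nlinarith [sq_nonneg (Real.exp (1 / 16 * radSum a b ^ 2) -
            Real.exp (1 / 16 * radSum c b ^ 2))]
      _ ≤ Real.exp (1 / 8) * Real.exp (1 / 4) := by
          rw [← Finset.mul_expect, ← Finset.expect_div, Finset.expect_add_distrib]
          have h1 := expect_exp_mul_radSum_sq_le ha (μ := 1 / 8) (by norm_num) le_rfl
          have h2 := expect_exp_mul_radSum_sq_le hc (μ := 1 / 8) (by norm_num) le_rfl
          norm_num at h1 h2 ⊢
          gcongr
          linarith
      _ ≤ 2 := by
          rw [← Real.exp_add]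
          have h := Real.exp_bound_div_one_sub_of_interval (x := 1 / 8 + 1 / 4) (by norm_num)
            (by norm_num)
          refine h.trans (by norm_num)
  -- A second-order expansion: the linear term has mean zero, so only a multiple of l² remains after
  -- averaging.
  have hpt : ∀ b, Real.exp (l * W b) ≤ 1 + l * W b + 512 * l ^ 2 * Real.exp (|W b| / 8) := by
    intro b
    have h' := exp_le_one_add_add_sq_mul_exp (l * W b)
    have h2 : |l * W b| ≤ |W b| / 16 := by
      rw [abs_mul]; nlinarith [abs_nonneg (W b)]
    have h3 : |l * W b| ^ 2 * Real.exp |l * W b| ≤ l ^ 2 * (512 * Real.exp (|W b| / 8)) := by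
      calc _ ≤ |l * W b| ^ 2 * Real.exp (|W b| / 16) := by gcongr
        _ = l ^ 2 * (|W b| ^ 2 * Real.exp (|W b| / 16)) := by
          rw [abs_mul, mul_pow, sq_abs l, mul_assoc]
        _ ≤ _ := mul_le_mul_of_nonneg_left (sq_mul_exp_le (abs_nonneg _)) (sq_nonneg _)
    linarith
  calc 𝔼 b, Real.exp (l * W b) ≤ 𝔼 b, (1 + l * W b + 512 * l ^ 2 * Real.exp (|W b| / 8)) :=
        Finset.expect_le_expect fun b _ => hpt b
    _ = 1 + 512 * l ^ 2 * 𝔼 b, Real.exp (|W b| / 8) := by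
        rw [Finset.expect_add_distrib, Finset.expect_add_distrib, ← Finset.mul_expect,
          ← Finset.mul_expect, hW0, Fintype.expect_const]
        ring
    _ ≤ 1 + 1024 * l ^ 2 := by nlinarith [sq_nonneg l]
    _ ≤ Real.exp (1024 * l ^ 2) := by linarith [Real.add_one_le_exp (1024 * l ^ 2)]

end Rademacher

/-! ### Independence of rows, and power moments from exponential moments -/

section Moments

/-- Averages of products over independent coordinates factor. -/
lemma expect_pi_prod {ι Y : Type*} [Fintype ι] [DecidableEq ι] [Fintype Y] (g : ι → Y → ℝ) :
    𝔼 b : ι → Y, ∏ i, g i (b i) = ∏ i, 𝔼 y, g i y := by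
  simp_rw [Fintype.expect_eq_sum_div_card]
  rw [Finset.prod_div_distrib, Finset.prod_univ_sum, Fintype.piFinset_univ]
  simp

lemma expect_exp_sum_le {ι Y : Type*} [Fintype ι] [DecidableEq ι] [Fintype Y]
    (g : ι → Y → ℝ) {B : ℝ} (h : ∀ i, 𝔼 y, Real.exp (g i y) ≤ Real.exp B) :
    𝔼 b : ι → Y, Real.exp (∑ i, g i (b i)) ≤ Real.exp (Fintype.card ι * B) := by
  simp_rw [Real.exp_sum]
  rw [expect_pi_prod (fun i y => Real.exp (g i y)), mul_comm, Real.exp_mul, Real.rpow_natCast]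
  calc ∏ i, 𝔼 y, Real.exp (g i y) ≤ ∏ _i : ι, Real.exp B :=
        Finset.prod_le_prod (fun i _ => Finset.expect_nonneg fun _ _ => Real.exp_nonneg _)
          fun i _ => h i
    _ = _ := by simp

lemma factorial_le_pow_self (p : ℕ) : (p.factorial : ℝ) ≤ (p : ℝ) ^ p := by
  exact_mod_cast Nat.factorial_le_pow p

/-- Exponential moments bound power moments. -/
lemma expect_pow_le {Ω : Type*} [Fintype Ω] (Z : Ω → ℝ) {p : ℕ} {l K : ℝ} (hp : Even p)
    (hl : 0 < l) (h1 : 𝔼 w, Real.exp (l * Z w) ≤ K) (h2 : 𝔼 w, Real.exp (-l * Z w) ≤ K) :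
    𝔼 w, Z w ^ p ≤ (p / l) ^ p * (2 * K) := by
  have hpt : ∀ w, Z w ^ p ≤ (p / l) ^ p * (Real.exp (l * Z w) + Real.exp (-l * Z w)) := by
    intro w
    -- One term of the exponential series gives z^p ≤ p!·e^z, and p! ≤ p^p; evenness of p removes
    -- the absolute value.
    have h := Real.pow_div_factorial_le_exp |l * Z w| (abs_nonneg _) p
    have h' : Real.exp |l * Z w| ≤ Real.exp (l * Z w) + Real.exp (-l * Z w) := by
      rw [neg_mul]
      exact Real.exp_abs_le _
    rw [div_le_iff₀ (by positivity), hp.pow_abs, mul_pow] at h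
    have h3 : l ^ p * Z w ^ p ≤ (Real.exp (l * Z w) + Real.exp (-l * Z w)) * (p : ℝ) ^ p :=
      h.trans (mul_le_mul h' (factorial_le_pow_self p) (by positivity) (by positivity))
    rw [div_pow, div_mul_eq_mul_div, le_div_iff₀ (by positivity)]
    linarith
  calc 𝔼 w, Z w ^ p ≤ 𝔼 w, (p / l) ^ p * (Real.exp (l * Z w) + Real.exp (-l * Z w)) :=
        Finset.expect_le_expect fun w _ => hpt w
    _ ≤ _ := by
        rw [← Finset.mul_expect, Finset.expect_add_distrib]
        gcongr
        linarith

lemma expect_pow_le_of_nonneg {Ω : Type*} [Fintype Ω] (Z : Ω → ℝ) {p : ℕ} {l K : ℝ}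
    (hZ : ∀ w, 0 ≤ Z w) (hl : 0 < l) (h1 : 𝔼 w, Real.exp (l * Z w) ≤ K) :
    𝔼 w, Z w ^ p ≤ (p / l) ^ p * K := by
  have hpt : ∀ w, Z w ^ p ≤ (p / l) ^ p * Real.exp (l * Z w) := by
    intro w
    have h := Real.pow_div_factorial_le_exp (l * Z w) (mul_nonneg hl.le (hZ w)) p
    rw [div_le_iff₀ (by positivity), mul_pow] at h
    have h3 : l ^ p * Z w ^ p ≤ Real.exp (l * Z w) * (p : ℝ) ^ p :=
      h.trans (mul_le_mul_of_nonneg_left (factorial_le_pow_self p) (by positivity))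
    rw [div_pow, div_mul_eq_mul_div, le_div_iff₀ (by positivity)]
    linarith
  calc 𝔼 w, Z w ^ p ≤ 𝔼 w, (p / l) ^ p * Real.exp (l * Z w) :=
        Finset.expect_le_expect fun w _ => hpt w
    _ ≤ _ := by
        rw [← Finset.mul_expect]
        gcongr

end Moments

/-! ### Functions of bounded degree in the hash values -/

section LowDegree

variable {T N : ℕ}

open Classical in
/-- The indicator function of the event that `f` agrees with `v` on `S`. -/
noncomputable def agree (S : Finset (Fin (T * N))) (v f : HashFn T N) : ℝ :=
  if ∀ j ∈ S, f j = v j then 1 else 0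

/-- Linear combinations of indicators of events that fix at most `d` hash values. -/
def lowDegree (T N d : ℕ) : Submodule ℝ (HashFn T N → ℝ) :=
  Submodule.span ℝ {G | ∃ (S : Finset (Fin (T * N))) (v : HashFn T N), S.card ≤ d ∧ G = agree S v}

lemma agree_mem_lowDegree {d : ℕ} {S : Finset (Fin (T * N))} (h : S.card ≤ d) (v : HashFn T N) :
    agree S v ∈ lowDegree T N d :=
  Submodule.subset_span ⟨S, v, h, rfl⟩

lemma lowDegree_mono {d d' : ℕ} (h : d ≤ d') : lowDegree T N d ≤ lowDegree T N d' :=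
  Submodule.span_mono fun _ ⟨S, v, hS, e⟩ => ⟨S, v, hS.trans h, e⟩

open Classical in
-- Two prescriptions either conflict on the overlap, and the product vanishes, or they merge into
-- one on the union. Hence degrees add under multiplication.
lemma agree_mul_agree (S S' : Finset (Fin (T * N))) (v v' : HashFn T N) :
    agree S v * agree S' v' =
      (if ∀ j ∈ S ∩ S', v j = v' j then (1 : ℝ) else 0) •
        agree (S ∪ S') (fun j => if j ∈ S then v j else v' j) := by
  ext f
  simp only [agree, Pi.mul_apply, Pi.smul_apply, smul_eq_mul, ← ite_and, mul_ite, mul_one,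
    mul_zero]
  congr 1
  simp only [eq_iff_iff, Finset.mem_inter, Finset.mem_union]
  grind

lemma mul_mem_lowDegree {d d' : ℕ} {F G : HashFn T N → ℝ} (hF : F ∈ lowDegree T N d)
    (hG : G ∈ lowDegree T N d') : F * G ∈ lowDegree T N (d + d') := by
  have h : lowDegree T N d * lowDegree T N d' ≤ lowDegree T N (d + d') := by
    classical
    rw [lowDegree, lowDegree, Submodule.span_mul_span, Submodule.span_le]
    rintro _ ⟨_, ⟨S, v, hS, rfl⟩, _, ⟨S', v', hS', rfl⟩, rfl⟩
    simp only [agree_mul_agree]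
    exact Submodule.smul_mem _ _
      (agree_mem_lowDegree ((Finset.card_union_le _ _).trans (add_le_add hS hS')) _)
  exact h (Submodule.mul_mem_mul hF hG)

lemma const_mem_lowDegree [Nonempty (HashFn T N)] (c : ℝ) (d : ℕ) :
    (fun _ => c) ∈ lowDegree T N d := by
  have h := (lowDegree T N d).smul_mem c
    (agree_mem_lowDegree (S := ∅) (by simp) (Classical.arbitrary (HashFn T N)))
  convert h using 1
  ext f
  simp [agree]

lemma pow_mem_lowDegree [Nonempty (HashFn T N)] {d : ℕ} {F : HashFn T N → ℝ}
    (hF : F ∈ lowDegree T N d) (p : ℕ) : F ^ p ∈ lowDegree T N (p * d) := by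
  induction p with
  | zero => exact const_mem_lowDegree 1 _
  | succ p ih =>
    rw [pow_succ, Nat.add_mul, one_mul]
    exact mul_mem_lowDegree ih hF

/-- The hash value with a given sign. -/
noncomputable def hashVal (T : ℕ) (b : Bool) : hashRange T :=
  if b then ⟨1 / √(T : ℝ), Or.inl rfl⟩ else ⟨-(1 / √(T : ℝ)), Or.inr rfl⟩

lemma coe_hashVal (T : ℕ) (b : Bool) : (hashVal T b : ℝ) = boolSign b * (1 / √(T : ℝ)) := by
  cases b <;> simp [hashVal, boolSign]

lemma hashVal_injective (hT : 0 < T) : Function.Injective (hashVal T) := by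
  intro b c h
  have h0 : (0 : ℝ) < 1 / √(T : ℝ) := by positivity
  have h' := congrArg Subtype.val h
  rw [coe_hashVal, coe_hashVal] at h'
  have := mul_right_cancel₀ h0.ne' h'
  cases b <;> cases c <;> simp_all [boolSign] <;> norm_num at this

lemma hashVal_surjective (T : ℕ) : Function.Surjective (hashVal T) := by
  rintro ⟨x, hx | hx⟩
  · exact ⟨true, Subtype.ext (by simp [hashVal, hx])⟩
  · exact ⟨false, Subtype.ext (by simp [hashVal, Set.mem_singleton_iff.1 hx])⟩

instance instNonemptyHashFn : Nonempty (HashFn T N) := ⟨fun _ => hashVal T true⟩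

instance instFiniteHashRange : Finite (hashRange T) := Finite.of_surjective _ (hashVal_surjective T)

lemma coord_mem_lowDegree (j : Fin (T * N)) :
    (fun f : HashFn T N => (f j : ℝ)) ∈ lowDegree T N 1 := by
  rcases Nat.eq_zero_or_pos T with rfl | hT
  · exact absurd j.2 (by simp)
  have h1 := (lowDegree T N 1).smul_mem (1 / √(T : ℝ))
    (agree_mem_lowDegree (S := {j}) (by simp) fun _ => hashVal T true)
  have h2 := (lowDegree T N 1).smul_mem (-(1 / √(T : ℝ)))
    (agree_mem_lowDegree (S := {j}) (by simp) fun _ => hashVal T false)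
  convert (lowDegree T N 1).add_mem h1 h2 using 1
  ext f
  obtain ⟨b, hb⟩ := hashVal_surjective T (f j)
  simp only [Pi.add_apply, Pi.smul_apply, agree, Finset.mem_singleton, forall_eq, ← hb,
    (hashVal_injective hT).eq_iff, coe_hashVal, smul_eq_mul]
  cases b <;> simp [boolSign]

end LowDegree

/-! ### From limited independence to uniform signs -/

section Transfer

variable {X : Type*} [Fintype X] (e : X ≃ Fin (Fintype.card X)) {T : ℕ}

/-- The hash function whose matrix has the signs `b`. -/
noncomputable def hashOfSigns (b : Fin T → X → Bool) : HashFn T (Fintype.card X) :=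
  fun j => hashVal T (b (finProdFinEquiv.symm j).1 (e.symm (finProdFinEquiv.symm j).2))

lemma hashOfSigns_apply (b : Fin T → X → Bool) (i : Fin T) (x : X) :
    hashOfSigns e b (finProdFinEquiv (i, e x)) = hashVal T (b i x) := by
  simp [hashOfSigns]

lemma projEntry_hashOfSigns (b : Fin T → X → Bool) (i : Fin T) (x : X) :
    projEntry e (hashOfSigns e b) i x = boolSign (b i x) * (1 / √(T : ℝ)) := by
  rw [projEntry, hashOfSigns_apply, coe_hashVal]

variable [DecidableEq X]

/-- The indicator is a product over matrix entries, each constrained entry contributing a factor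
1/2. This is the same value that `IsWiseIndependent` prescribes for small `S`. -/
lemma expect_agree_hashOfSigns (hT : 0 < T) (S : Finset (Fin (T * Fintype.card X)))
    (v : HashFn T (Fintype.card X)) :
    𝔼 b : Fin T → X → Bool, agree S v (hashOfSigns e b) = (1 / 2) ^ S.card := by
  classical
  let J : Fin T × X ≃ Fin (T * Fintype.card X) :=
    ((Equiv.refl (Fin T)).prodCongr e).trans finProdFinEquiv
  let h : Fin T → X → Bool → ℝ := fun i x c =>
    if J (i, x) ∈ S then (if hashVal T c = v (J (i, x)) then 1 else 0) else 1
  have h1 : ∀ b : Fin T → X → Bool,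
      agree S v (hashOfSigns e b) = ∏ i, ∏ x, h i x (b i x) := by
    intro b
    rw [← Fintype.prod_prod_type' (f := fun i x => h i x (b i x))]
    have h2 : ∀ q : Fin T × X, h q.1 q.2 (b q.1 q.2) =
        if (J q ∈ S → hashOfSigns e b (J q) = v (J q)) then 1 else 0 := by
      rintro ⟨i, x⟩
      have : hashOfSigns e b (J (i, x)) = hashVal T (b i x) := hashOfSigns_apply e b i x
      by_cases hS : J (i, x) ∈ S <;> simp [h, hS, this]
    simp_rw [h2]
    rw [Finset.prod_ite_zero]
    have h4 : (∀ j ∈ S, hashOfSigns e b j = v j) ↔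
        ∀ q, J q ∈ S → hashOfSigns e b (J q) = v (J q) :=
      (J.forall_congr_right (q := fun j => j ∈ S → hashOfSigns e b j = v j)).symm
    simp only [agree, h4, Finset.mem_univ, forall_true_left, Finset.prod_const_one]
  have h3 : ∀ i x, 𝔼 c, h i x c = if J (i, x) ∈ S then (1 / 2 : ℝ) else 1 := by
    intro i x
    by_cases hS : J (i, x) ∈ S
    · obtain ⟨c, hc⟩ := hashVal_surjective T (v (J (i, x)))
      simp only [h, hS, if_true, ← hc, (hashVal_injective hT).eq_iff]
      simp
    · simp [h, hS]
  simp_rw [h1]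
  rw [expect_pi_prod (fun i (y : X → Bool) => ∏ x, h i x (y x))]
  simp_rw [expect_pi_prod (h _), h3]
  rw [← Fintype.prod_prod_type' (f := fun i x => if J (i, x) ∈ S then (1 / 2 : ℝ) else 1),
    Fintype.prod_equiv J _ (fun j => if j ∈ S then (1 / 2 : ℝ) else 1) fun _ => rfl,
    Finset.prod_ite_mem]
  simp

/-- An `r`-wise independent family integrates functions of degree at most `r` as the uniform
distribution does. -/
lemma integral_eq_expect_of_mem_lowDegree (hT : 0 < T) {r : ℕ}
    {H : PMF (HashFn T (Fintype.card X))} (hH : IsWiseIndependent r H)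
    {F : HashFn T (Fintype.card X) → ℝ} (hF : F ∈ lowDegree T (Fintype.card X) r) :
    ∫ f, F f ∂H.toMeasure = 𝔼 b : Fin T → X → Bool, F (hashOfSigns e b) := by
  classical
  induction hF using Submodule.span_induction with
  | mem G hG =>
    obtain ⟨S, v, hS, rfl⟩ := hG
    rw [expect_agree_hashOfSigns e hT]
    have : agree S v = Set.indicator {f | ∀ j ∈ S, f j = v j} fun _ => (1 : ℝ) := by
      ext f; simp [agree, Set.indicator_apply]
    rw [this, integral_indicator (Set.toFinite _).measurableSet, setIntegral_const, Measure.real,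
      hH S hS v]
    simp
  | zero => simp
  | add F G _ _ hF hG =>
    simp only [Pi.add_apply]
    rw [integral_add Integrable.of_finite Integrable.of_finite, hF, hG,
      Finset.expect_add_distrib]
  | smul c F _ hF =>
    simp only [Pi.smul_apply, smul_eq_mul]
    rw [integral_const_mul, hF, Finset.mul_expect]

/-- Tail bound for a function of degree `d` under an `r`-wise independent family. -/
lemma measure_abs_ge_le (hT : 0 < T) {r : ℕ}
    {H : PMF (HashFn T (Fintype.card X))} (hH : IsWiseIndependent r H)
    {F : HashFn T (Fintype.card X) → ℝ} {d : ℕ} (hF : F ∈ lowDegree T (Fintype.card X) d)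
    {p : ℕ} (hp : Even p) (hr : p * d ≤ r) {t K : ℝ} (ht : 0 < t)
    (hK : 𝔼 b : Fin T → X → Bool, F (hashOfSigns e b) ^ p ≤ t ^ p * K) :
    H.toMeasure.real {f | t ≤ |F f|} ≤ K := by
  have h1 := integral_eq_expect_of_mem_lowDegree e hT hH
    (lowDegree_mono hr (pow_mem_lowDegree hF p))
  -- Markov's inequality for the p-th power, whose integral `h1` has turned into an average over
  -- signs.
  have h2 := mul_meas_ge_le_integral_of_nonneg (μ := H.toMeasure) (f := fun f => F f ^ p)
    (Filter.Eventually.of_forall fun f => hp.pow_nonneg _) Integrable.of_finite (t ^ p)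
  have h3 : H.toMeasure.real {f | t ≤ |F f|} ≤ H.toMeasure.real {f | t ^ p ≤ F f ^ p} := by
    refine measureReal_mono fun f hf => ?_
    simp only [Set.mem_ofPred_eq] at hf ⊢
    rw [← hp.pow_abs (F f)]
    exact pow_le_pow_left₀ ht.le hf p
  simp only [Pi.pow_apply] at h1
  rw [h1] at h2
  refine h3.trans (le_of_mul_le_mul_left (h2.trans hK) (by positivity))

end Transfer

/-! ### Random projection: inner products and norms -/

section Projection

variable {X : Type*} [Fintype X] (e : X ≃ Fin (Fintype.card X)) {T : ℕ}

/-- The projection of the vector `a` by the matrix represented by `f`. -/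
def projVec (f : HashFn T (Fintype.card X)) (a : X → ℝ) (i : Fin T) : ℝ :=
  ∑ x, a x * projEntry e f i x

lemma projQuery_eq_projVec (f : HashFn T (Fintype.card X)) (Q : LinearQuery X) :
    projQuery e f Q = projVec e f fun x => (Q x : ℝ) := by
  classical
  ext i
  rw [projQuery, projVec, Finset.sum_filter]
  refine Finset.sum_congr (by congr) fun x _ => ?_
  split_ifs with h
  · rfl
  · rw [le_antisymm (not_lt.1 h) (Q x).2.1, zero_mul]

lemma projDatabase_eq_projVec {n : ℕ} (f : HashFn T (Fintype.card X)) (D : Sym X n) :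
    projDatabase e f D = projVec e f fun x => (occ D x : ℝ) := by
  ext i
  rw [projDatabase, projVec, Finset.sum_filter]
  refine Finset.sum_congr rfl fun x _ => ?_
  split_ifs with h
  · rfl
  · rw [Nat.eq_zero_of_not_pos h, Nat.cast_zero, zero_mul]

/-- Pulling out s, later a bound on the norm of `a`, reduces to Rademacher sums with coefficient
vector of norm at most 1. -/
lemma projVec_hashOfSigns (a : X → ℝ) {s : ℝ} (hs : s ≠ 0) (b : Fin T → X → Bool) (i : Fin T) :
    projVec e (hashOfSigns e b) a i = s / √(T : ℝ) * radSum (fun x => a x / s) (b i) := by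
  rw [projVec, radSum, Finset.mul_sum]
  refine Finset.sum_congr rfl fun x _ => ?_
  rw [projEntry_hashOfSigns]
  field_simp

lemma projVec_mem_lowDegree (a : X → ℝ) (i : Fin T) :
    (fun f => projVec e f a i) ∈ lowDegree T (Fintype.card X) 1 := by
  have h : (fun f => projVec e f a i) = ∑ x, a x • fun f : HashFn T (Fintype.card X) =>
      ((f (finProdFinEquiv (i, e x)) : ℝ)) := by
    ext f
    simp [projVec, projEntry]
  rw [h]
  exact Submodule.sum_mem _ fun x _ => Submodule.smul_mem _ _ (coord_mem_lowDegree _)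

lemma sum_projVec_mul_mem_lowDegree (a c : X → ℝ) :
    (fun f => ∑ i : Fin T, projVec e f a i * projVec e f c i) ∈
      lowDegree T (Fintype.card X) 2 := by
  have h : (fun f => ∑ i : Fin T, projVec e f a i * projVec e f c i) =
      ∑ i : Fin T, (fun f => projVec e f a i) * fun f => projVec e f c i := by
    ext f
    simp
  rw [h]
  refine Submodule.sum_mem _ fun i _ => ?_
  have h2 := mul_mem_lowDegree (projVec_mem_lowDegree e a i) (projVec_mem_lowDegree e c i)
  exact h2

lemma sum_div_sq_le_one {a : X → ℝ} {s : ℝ} (hs : 0 < s) (ha : ∑ x, a x ^ 2 ≤ s ^ 2) :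
    ∑ x, (a x / s) ^ 2 ≤ 1 := by
  simp_rw [div_pow, ← Finset.sum_div]
  exact (div_le_one (by positivity)).2 ha

lemma exp_one_div_le_two : Real.exp (1 / 32) ≤ 2 :=
  (Real.exp_bound_div_one_sub_of_interval (by norm_num) (by norm_num)).trans (by norm_num)

variable [DecidableEq X]

/-- After normalisation each of the T independent rows has parameter q = lst/T and costs a factor
exp(1024q²). The total exponent 1024(lst)²/T is at most 1/32. -/
lemma expect_exp_inner_sub_le (hT : 0 < T) {a c : X → ℝ} {s t l : ℝ} (hs : 0 < s) (ht : 0 < t)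
    (ha : ∑ x, a x ^ 2 ≤ s ^ 2) (hc : ∑ x, c x ^ 2 ≤ t ^ 2)
    (h1 : |l| * (s * t) ≤ T / 16) (h2 : 32768 * (l * (s * t)) ^ 2 ≤ T) :
    𝔼 b : Fin T → X → Bool, Real.exp (l * (∑ i, projVec e (hashOfSigns e b) a i *
      projVec e (hashOfSigns e b) c i - ∑ x, a x * c x)) ≤ 2 := by
  have hT' : (0 : ℝ) < T := by exact_mod_cast hT
  set q := l * (s * t) / T with hq
  have hq1 : |q| ≤ 1 / 16 := by
    rw [hq, abs_div, abs_mul, abs_of_pos hT', abs_of_pos (mul_pos hs ht), div_le_iff₀ hT']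
    linarith
  have hb : ∀ b : Fin T → X → Bool, l * (∑ i, projVec e (hashOfSigns e b) a i *
      projVec e (hashOfSigns e b) c i - ∑ x, a x * c x) =
      ∑ i, q * (radSum (fun x => a x / s) (b i) * radSum (fun x => c x / t) (b i) -
        ∑ x, a x / s * (c x / t)) := by
    intro b
    simp_rw [projVec_hashOfSigns e a hs.ne', projVec_hashOfSigns e c ht.ne']
    have e1 : ∑ x, a x / s * (c x / t) = (∑ x, a x * c x) / (s * t) := by
      rw [Finset.sum_div]
      exact Finset.sum_congr rfl fun x _ => by field_simp
    rw [e1, ← Finset.mul_sum, Finset.sum_sub_distrib, Finset.sum_const, Finset.card_univ,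
      Fintype.card_fin, nsmul_eq_mul, mul_sub, mul_sub]
    congr 1
    · rw [Finset.mul_sum, Finset.mul_sum]
      refine Finset.sum_congr rfl fun i _ => ?_
      rw [hq, mul_mul_mul_comm, div_mul_div_comm, Real.mul_self_sqrt hT'.le]
      ring
    · rw [hq]
      field_simp
  simp_rw [hb]
  refine (expect_exp_sum_le (fun _ y => q * (radSum (fun x => a x / s) y *
    radSum (fun x => c x / t) y - ∑ x, a x / s * (c x / t))) fun _ =>
    expect_exp_radSum_mul_le (sum_div_sq_le_one hs ha) (sum_div_sq_le_one ht hc) hq1).trans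
    (le_trans (Real.exp_le_exp.2 ?_) exp_one_div_le_two)
  rw [Fintype.card_fin, hq, div_pow]
  have : (T : ℝ) * (1024 * ((l * (s * t)) ^ 2 / T ^ 2)) = 1024 * (l * (s * t)) ^ 2 / T := by
    field_simp
  rw [this, div_le_iff₀ hT']
  linarith

/-- The projection approximately preserves inner products. -/
lemma measure_inner_sub_ge_le (hT : 0 < T) {r : ℕ} {H : PMF (HashFn T (Fintype.card X))}
    (hH : IsWiseIndependent r H) {a c : X → ℝ} {s t l : ℝ} (hs : 0 < s) (ht : 0 < t)
    (ha : ∑ x, a x ^ 2 ≤ s ^ 2) (hc : ∑ x, c x ^ 2 ≤ t ^ 2) (hl : 0 < l)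
    (h1 : l * (s * t) ≤ T / 16) (h2 : 32768 * (l * (s * t)) ^ 2 ≤ T)
    {p : ℕ} (hp : Even p) (hp0 : 0 < p) (hr : p * 2 ≤ r) :
    H.toMeasure.real {f | 2 * p / l ≤
      |∑ i, projVec e f a i * projVec e f c i - ∑ x, a x * c x|} ≤ 4 * (1 / 2) ^ p := by
  refine measure_abs_ge_le e hT hH
    (Submodule.sub_mem _ (sum_projVec_mul_mem_lowDegree e a c) (const_mem_lowDegree _ 2))
    hp hr (by positivity) ?_
  have h3 := expect_pow_le (fun b : Fin T → X → Bool => ∑ i, projVec e (hashOfSigns e b) a i *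
    projVec e (hashOfSigns e b) c i - ∑ x, a x * c x) hp hl
    (expect_exp_inner_sub_le e hT hs ht ha hc (by rwa [abs_of_pos hl]) h2)
    (expect_exp_inner_sub_le e hT hs ht ha hc (by rwa [abs_neg, abs_of_pos hl])
      (by simpa using h2))
  -- The moment bound is 4(p/l)^p; doubling the threshold gains the factor 2^(-p).
  refine h3.trans (le_of_eq ?_)
  rw [mul_div_assoc, mul_pow 2, one_div, inv_pow]
  field_simp
  norm_num

/-- The projection does not expand the norm much. -/
lemma measure_norm_sq_ge_le (hT : 0 < T) {r : ℕ} {H : PMF (HashFn T (Fintype.card X))}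
    (hH : IsWiseIndependent r H) {a : X → ℝ} {s : ℝ} (hs : 0 < s)
    (ha : ∑ x, a x ^ 2 ≤ s ^ 2) {p : ℕ} (hp : Even p) (hp0 : 0 < p) (hr : p * 2 ≤ r)
    (hpT : 8 * p ≤ T) :
    H.toMeasure.real {f | 16 * s ^ 2 ≤ ∑ i, projVec e f a i ^ 2} ≤ (1 / 2) ^ p := by
  have hT' : (0 : ℝ) < T := by exact_mod_cast hT
  have hp' : (0 : ℝ) < p := by exact_mod_cast hp0
  have hpT' : (8 : ℝ) * p ≤ T := by exact_mod_cast hpT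
  have h0 : ∀ f : HashFn T (Fintype.card X), 0 ≤ ∑ i, projVec e f a i * projVec e f a i :=
    fun f => Finset.sum_nonneg fun i _ => mul_self_nonneg _
  -- With exponent p/s² every row has parameter μ = p/T, and `hpT` is exactly μ ≤ 1/8. The p-th
  -- moment is then at most (e²s²)^p ≤ (8s²)^p, half the threshold inside the power.
  have h1 : 𝔼 b : Fin T → X → Bool, Real.exp (p / s ^ 2 * ∑ i, projVec e (hashOfSigns e b) a i *
      projVec e (hashOfSigns e b) a i) ≤ Real.exp (2 * p) := by
    have hb : ∀ b : Fin T → X → Bool, p / s ^ 2 * ∑ i, projVec e (hashOfSigns e b) a i *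
        projVec e (hashOfSigns e b) a i =
        ∑ i, (p : ℝ) / T * radSum (fun x => a x / s) (b i) ^ 2 := by
      intro b
      rw [Finset.mul_sum]
      refine Finset.sum_congr rfl fun i _ => ?_
      rw [projVec_hashOfSigns e a hs.ne', mul_mul_mul_comm, div_mul_div_comm,
        Real.mul_self_sqrt hT'.le]
      field_simp
    simp_rw [hb]
    refine (expect_exp_sum_le (fun _ y => (p : ℝ) / T * radSum (fun x => a x / s) y ^ 2) fun _ =>
      expect_exp_mul_radSum_sq_le (sum_div_sq_le_one hs ha) (by positivity) ?_).trans
      (le_of_eq ?_)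
    · rw [div_le_iff₀ hT']; linarith
    · rw [Fintype.card_fin]; congr 1; field_simp
  have h2 := expect_pow_le_of_nonneg (fun b : Fin T → X → Bool =>
    ∑ i, projVec e (hashOfSigns e b) a i * projVec e (hashOfSigns e b) a i) (p := p)
    (fun b => h0 _) (by positivity) h1
  have h3 := measure_abs_ge_le e hT hH (sum_projVec_mul_mem_lowDegree e a a) hp hr
    (t := 16 * s ^ 2) (K := (1 / 2) ^ p) (by positivity) (h2.trans ?_)
  · simp_rw [sq (projVec e _ a _)]
    simpa only [abs_of_nonneg (h0 _)] using h3
  · have he : Real.exp 2 ≤ 8 := by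
      have : Real.exp 2 = Real.exp 1 * Real.exp 1 := by rw [← Real.exp_add]; norm_num
      rw [this]
      nlinarith [Real.exp_one_lt_d9, Real.exp_pos 1]
    rw [mul_comm 2 (p : ℝ), Real.exp_nat_mul, ← mul_pow, ← mul_pow]
    refine pow_le_pow_left₀ (by positivity) ?_ p
    have : (p : ℝ) / (p / s ^ 2) = s ^ 2 := by field_simp
    rw [this]
    nlinarith [sq_nonneg s]

end Projection

/-! ### Norms of sparse queries and databases -/

section Inputs

variable {X : Type*} [Fintype X]

lemma sum_sq_le_of_isSparse {m : ℕ} {Q : LinearQuery X} (h : IsSparse m Q) :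
    ∑ x, (Q x : ℝ) ^ 2 ≤ √(m : ℝ) ^ 2 := by
  classical
  rw [Real.sq_sqrt (Nat.cast_nonneg m)]
  calc ∑ x, (Q x : ℝ) ^ 2 ≤ ∑ x, if 0 < (Q x : ℝ) then (1 : ℝ) else 0 := by
        refine Finset.sum_le_sum fun x _ => ?_
        split_ifs with hx
        · exact pow_le_one₀ (Q x).2.1 (Q x).2.2
        · rw [le_antisymm (not_lt.1 hx) (Q x).2.1]; norm_num
    _ = ({x : X | 0 < (Q x : ℝ)}.ncard : ℝ) := by
        rw [Finset.sum_boole, Set.ncard_eq_toFinset_card']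
        simp
    _ ≤ m := by exact_mod_cast h

lemma sum_occ {n : ℕ} (D : Sym X n) : ∑ x, occ D x = n := by
  classical
  have h := Multiset.sum_count_eq_card (s := Finset.univ) (m := (D : Multiset X)) (by simp)
  rw [Sym.card_coe] at h
  refine Eq.trans (Finset.sum_congr rfl fun x _ => ?_) h
  rw [occ]

lemma sum_occ_sq_le {n : ℕ} (D : Sym X n) : ∑ x, (occ D x : ℝ) ^ 2 ≤ (n : ℝ) ^ 2 := by
  have h := Finset.sum_sq_le_sq_sum_of_nonneg (s := Finset.univ) (f := fun x => (occ D x : ℝ))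
    fun x _ => Nat.cast_nonneg _
  rwa [← Nat.cast_sum, sum_occ] at h

lemma queryValue_eq_sum {n : ℕ} (Q : LinearQuery X) (D : Sym X n) :
    queryValue Q D = 1 / n * ∑ x, (Q x : ℝ) * occ D x := by
  classical
  rw [queryValue, Finset.sum_multiset_map_count]
  congr 1
  rw [Finset.sum_subset (Finset.subset_univ _)]
  · refine Finset.sum_congr rfl fun x _ => ?_
    rw [nsmul_eq_mul, mul_comm, occ]
  · intro x _ hx
    rw [Multiset.mem_toFinset] at hx
    simp [Multiset.count_eq_zero_of_notMem hx]

end Inputs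

/-! ### Tails of linear combinations of Laplace variables -/

section Laplace

lemma laplace_density_nonneg {b : ℝ} (hb : 0 < b) (x : ℝ) :
    0 ≤ 1 / (2 * b) * Real.exp (-|x| / b) := by positivity

lemma measurable_laplace_density (b : ℝ) :
    Measurable fun x : ℝ => ENNReal.ofReal (1 / (2 * b) * Real.exp (-|x| / b)) := by
  fun_prop

/-- Integrability and value of the exponential moment of the Laplace density. -/
lemma integral_laplace_density_mul_exp {b a : ℝ} (hb : 0 < b) (hab : |a| * b < 1) :
    Integrable (fun x : ℝ => 1 / (2 * b) * Real.exp (-|x| / b) * Real.exp (a * x)) ∧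
      ∫ x : ℝ, 1 / (2 * b) * Real.exp (-|x| / b) * Real.exp (a * x) =
        1 / (1 - (a * b) ^ 2) := by
  have h1 : a * b < 1 := lt_of_le_of_lt (by gcongr; exact le_abs_self a) hab
  have h2 : -a * b < 1 := lt_of_le_of_lt (by gcongr; exact neg_le_abs a) hab
  have hneg : a - 1 / b < 0 := by rw [sub_neg, lt_div_iff₀ hb]; exact h1
  have hpos : 0 < a + 1 / b := by
    have : -a < 1 / b := by rw [lt_div_iff₀ hb]; exact h2
    linarith
  have e1 : Set.EqOn (fun x : ℝ => 1 / (2 * b) * Real.exp ((a - 1 / b) * x))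
      (fun x : ℝ => 1 / (2 * b) * Real.exp (-|x| / b) * Real.exp (a * x)) (Set.Ioi 0) := by
    intro x hx
    simp only
    rw [abs_of_pos hx, mul_assoc, ← Real.exp_add]
    congr 2
    field_simp
    ring
  have e2 : Set.EqOn (fun x : ℝ => 1 / (2 * b) * Real.exp ((a + 1 / b) * x))
      (fun x : ℝ => 1 / (2 * b) * Real.exp (-|x| / b) * Real.exp (a * x)) (Set.Iic 0) := by
    intro x hx
    simp only
    rw [abs_of_nonpos hx, mul_assoc, ← Real.exp_add]
    congr 2
    field_simp
    ring
  have i1 := IntegrableOn.congr_fun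
    (Integrable.const_mul (integrableOn_exp_mul_Ioi hneg 0) (1 / (2 * b))) e1 measurableSet_Ioi
  have i2 := IntegrableOn.congr_fun
    (Integrable.const_mul (integrableOn_exp_mul_Iic hpos 0) (1 / (2 * b))) e2 measurableSet_Iic
  refine ⟨?_, ?_⟩
  · rw [← integrableOn_univ, ← Set.Iic_union_Ioi (a := (0 : ℝ))]
    exact i2.union i1
  · rw [← intervalIntegral.integral_Iic_add_Ioi i2 i1,
      ← setIntegral_congr_fun measurableSet_Ioi e1, ← setIntegral_congr_fun measurableSet_Iic e2,
      integral_const_mul, integral_const_mul, integral_exp_mul_Ioi hneg,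
      integral_exp_mul_Iic hpos]
    have h3 : 1 - a * b ≠ 0 := by linarith
    have h4 : 1 + a * b ≠ 0 := by linarith
    have h5 : 1 - (a * b) ^ 2 = (1 - a * b) * (1 + a * b) := by ring
    have e3 : a - 1 / b = -(1 - a * b) / b := by field_simp; ring
    have e4 : a + 1 / b = (1 + a * b) / b := by field_simp; ring
    rw [e3, e4, h5]
    simp only [mul_zero, Real.exp_zero]
    generalize a * b = y at h3 h4 ⊢
    field_simp
    ring

lemma isProbabilityMeasure_laplace {b : ℝ} (hb : 0 < b) : IsProbabilityMeasure (laplace b) := by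
  obtain ⟨hi, he⟩ := integral_laplace_density_mul_exp (a := 0) hb (by simp)
  simp only [zero_mul, Real.exp_zero, mul_one] at hi he
  refine ⟨?_⟩
  rw [laplace, withDensity_apply _ MeasurableSet.univ, Measure.restrict_univ,
    ← ofReal_integral_eq_lintegral_ofReal hi
      (Filter.Eventually.of_forall (laplace_density_nonneg hb)), he]
  norm_num

lemma integrable_exp_mul_laplace {b a : ℝ} (hb : 0 < b) (hab : |a| * b < 1) :
    Integrable (fun x => Real.exp (a * x)) (laplace b) := by
  rw [laplace, integrable_withDensity_iff (measurable_laplace_density b)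
    (Filter.Eventually.of_forall fun _ => ENNReal.ofReal_lt_top)]
  simp_rw [ENNReal.toReal_ofReal (laplace_density_nonneg hb _), mul_comm (Real.exp (a * _))]
  exact (integral_laplace_density_mul_exp hb hab).1

lemma integral_exp_mul_laplace {b a : ℝ} (hb : 0 < b) (hab : |a| * b < 1) :
    ∫ x, Real.exp (a * x) ∂laplace b = 1 / (1 - (a * b) ^ 2) := by
  rw [laplace, integral_withDensity_eq_integral_toReal_smul (measurable_laplace_density b)
    (Filter.Eventually.of_forall fun _ => ENNReal.ofReal_lt_top)]
  simp_rw [ENNReal.toReal_ofReal (laplace_density_nonneg hb _), smul_eq_mul]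
  exact (integral_laplace_density_mul_exp hb hab).2

lemma integral_exp_mul_laplace_le {b a : ℝ} (hb : 0 < b) (hab : |a| * b ≤ 1 / 2) :
    ∫ x, Real.exp (a * x) ∂laplace b ≤ Real.exp (2 * (a * b) ^ 2) := by
  rw [integral_exp_mul_laplace hb (by linarith)]
  have h : (a * b) ^ 2 ≤ 1 / 4 := by
    rw [← sq_abs, abs_mul, abs_of_pos hb]
    nlinarith [mul_nonneg (abs_nonneg a) hb.le]
  rw [div_le_iff₀ (by linarith)]
  nlinarith [Real.add_one_le_exp (2 * (a * b) ^ 2), sq_nonneg (a * b)]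

variable {ι : Type*} [Fintype ι]

/-- One-sided tail bound for linear combinations of independent Laplace variables. -/
lemma measure_le_sum_laplace_le {b l V u : ℝ} (hb : 0 < b) (hl : 0 ≤ l) (a : ι → ℝ)
    (ha : ∑ i, a i ^ 2 ≤ V) (hV : l ^ 2 * V * b ^ 2 ≤ 1 / 4) :
    (Measure.pi fun _ : ι => laplace b).real {ν | u ≤ ∑ i, a i * ν i} ≤
      2 * Real.exp (-(l * u)) := by
  have := isProbabilityMeasure_laplace hb
  -- A single coefficient satisfies a_i² ≤ V, so `hV` keeps every coordinate well inside the range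
  -- where the moment generating function is finite.
  have hab : ∀ i, |l * a i| * b ≤ 1 / 2 := by
    intro i
    have h1 : a i ^ 2 ≤ V :=
      (Finset.single_le_sum (fun i _ => sq_nonneg (a i)) (Finset.mem_univ i)).trans ha
    refine abs_le_of_sq_le_sq' ?_ (by norm_num) |>.2
    rw [mul_pow, sq_abs, mul_pow]
    calc l ^ 2 * a i ^ 2 * b ^ 2 ≤ l ^ 2 * V * b ^ 2 := by gcongr
      _ ≤ _ := by linarith
  have hexp : ∀ ν : ι → ℝ, Real.exp (l * ∑ i, a i * ν i) = ∏ i, Real.exp (l * a i * ν i) := by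
    intro ν
    rw [Finset.mul_sum, Real.exp_sum]
    exact Finset.prod_congr rfl fun i _ => by rw [mul_assoc]
  have hint : Integrable (fun ν : ι → ℝ => Real.exp (l * ∑ i, a i * ν i))
      (Measure.pi fun _ : ι => laplace b) := by
    simp_rw [hexp]
    exact Integrable.fintype_prod (f := fun i x => Real.exp (l * a i * x))
      fun i => integrable_exp_mul_laplace hb (by linarith [hab i])
  have hval : ∫ ν, Real.exp (l * ∑ i, a i * ν i) ∂(Measure.pi fun _ : ι => laplace b) ≤ 2 := by
    simp_rw [hexp]
    rw [integral_fintype_prod_eq_prod (f := fun i x => Real.exp (l * a i * x))]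
    calc _ ≤ ∏ i, Real.exp (2 * (l * a i * b) ^ 2) :=
          Finset.prod_le_prod (fun i _ => integral_nonneg fun _ => Real.exp_nonneg _)
            fun i _ => integral_exp_mul_laplace_le hb (hab i)
      _ = Real.exp (2 * (l ^ 2 * (∑ i, a i ^ 2) * b ^ 2)) := by
          rw [← Real.exp_sum, Finset.mul_sum, Finset.sum_mul, Finset.mul_sum]
          congr 1
          exact Finset.sum_congr rfl fun i _ => by ring
      _ ≤ Real.exp (1 / 2) := by
          refine Real.exp_le_exp.2 ?_
          have : l ^ 2 * (∑ i, a i ^ 2) * b ^ 2 ≤ l ^ 2 * V * b ^ 2 := by gcongr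
          linarith
      _ ≤ 2 := (Real.exp_bound_div_one_sub_of_interval (by norm_num) (by norm_num)).trans
          (by norm_num)
  have hm := mul_meas_ge_le_integral_of_nonneg
    (Filter.Eventually.of_forall fun _ => Real.exp_nonneg _) hint (Real.exp (l * u))
  have hsub : (Measure.pi fun _ : ι => laplace b).real {ν | u ≤ ∑ i, a i * ν i} ≤
      (Measure.pi fun _ : ι => laplace b).real
        {ν | Real.exp (l * u) ≤ Real.exp (l * ∑ i, a i * ν i)} := by
    refine measureReal_mono fun ν hν => ?_
    simp only [Set.mem_ofPred_eq] at hν ⊢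
    exact Real.exp_le_exp.2 (mul_le_mul_of_nonneg_left hν hl)
  rw [Real.exp_neg, ← div_eq_mul_inv, le_div_iff₀ (Real.exp_pos _), mul_comm]
  exact (mul_le_mul_of_nonneg_left hsub (Real.exp_nonneg _)).trans (hm.trans hval)

/-- Two-sided tail bound for linear combinations of independent Laplace variables. -/
lemma measure_le_abs_sum_laplace_le {b l V u : ℝ} (hb : 0 < b) (hl : 0 ≤ l) (a : ι → ℝ)
    (ha : ∑ i, a i ^ 2 ≤ V) (hV : l ^ 2 * V * b ^ 2 ≤ 1 / 4) :
    (Measure.pi fun _ : ι => laplace b).real {ν | u ≤ |∑ i, a i * ν i|} ≤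
      4 * Real.exp (-(l * u)) := by
  have := isProbabilityMeasure_laplace hb
  have h1 := measure_le_sum_laplace_le (u := u) hb hl a ha hV
  have h2 := measure_le_sum_laplace_le (u := u) hb hl (fun i => -a i) (by simpa using ha) hV
  have hsub : {ν : ι → ℝ | u ≤ |∑ i, a i * ν i|} ⊆
      {ν | u ≤ ∑ i, a i * ν i} ∪ {ν | u ≤ ∑ i, -a i * ν i} := by
    intro ν hν
    simpa [le_abs] using hν
  linarith [(measureReal_mono (μ := Measure.pi fun _ : ι => laplace b) hsub).trans
    (measureReal_union_le _ _)]

end Laplace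

/-! ### Numerical consequences of the choice of parameters -/

section Parameters

variable {n m k : ℕ} {β : ℝ}

/-- The even moment used in the analysis. -/
noncomputable def momentOrder (β : ℝ) (k : ℕ) : ℕ := 2 * ⌈Real.logb 2 (16 * k / β) / 2⌉₊

lemma even_momentOrder (β : ℝ) (k : ℕ) : Even (momentOrder β k) := even_two_mul _

lemma one_lt_div (hk : 1 ≤ k) (h0 : 0 < β) (h1 : β < 1) : 1 < (k : ℝ) / β := by
  have : (1 : ℝ) ≤ k := by exact_mod_cast hk
  rw [lt_div_iff₀ h0]
  linarith

lemma logb_two_pow_mul (j : ℕ) (hk : 1 ≤ k) (h0 : 0 < β) (h1 : β < 1) :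
    Real.logb 2 (2 ^ j * (k / β)) = j + Real.logb 2 (k / β) := by
  rw [Real.logb_mul (by positivity) (by linarith [one_lt_div hk h0 h1]), Real.logb_pow,
    Real.logb_self_eq_one (by norm_num), mul_one]

lemma logb_div_pos (hk : 1 ≤ k) (h0 : 0 < β) (h1 : β < 1) : 0 < Real.logb 2 (k / β) :=
  Real.logb_pos (by norm_num) (one_lt_div hk h0 h1)

lemma le_momentOrder (hk : 1 ≤ k) (h0 : 0 < β) (h1 : β < 1) :
    4 + Real.logb 2 (k / β) ≤ momentOrder β k := by
  have h := Nat.le_ceil (Real.logb 2 (16 * k / β) / 2)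
  have e := logb_two_pow_mul 4 hk h0 h1
  rw [← mul_div_assoc] at e
  norm_num at e
  rw [momentOrder]
  push_cast
  linarith

lemma momentOrder_le (hk : 1 ≤ k) (h0 : 0 < β) (h1 : β < 1) :
    (momentOrder β k : ℝ) ≤ 6 + Real.logb 2 (k / β) := by
  have e := logb_two_pow_mul 4 hk h0 h1
  rw [← mul_div_assoc] at e
  norm_num at e
  have h := Nat.ceil_lt_add_one (a := Real.logb 2 (16 * k / β) / 2)
    (by linarith [logb_div_pos hk h0 h1])
  rw [momentOrder]
  push_cast
  linarith

lemma momentOrder_pos (hk : 1 ≤ k) (h0 : 0 < β) (h1 : β < 1) : 0 < momentOrder β k := by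
  have h : (0 : ℝ) < momentOrder β k := by
    linarith [le_momentOrder hk h0 h1, logb_div_pos hk h0 h1]
  exact_mod_cast h

lemma half_pow_momentOrder_le (hk : 1 ≤ k) (h0 : 0 < β) (h1 : β < 1) :
    (1 / 2 : ℝ) ^ momentOrder β k ≤ β / (16 * k) := by
  have hk' : (0 : ℝ) < k := by exact_mod_cast hk
  have h := le_momentOrder hk h0 h1
  have e := logb_two_pow_mul 4 hk h0 h1
  push_cast at e
  rw [← e, Real.logb_le_iff_le_rpow (by norm_num) (by positivity), Real.rpow_natCast] at h
  rw [one_div, inv_pow, inv_le_comm₀ (by positivity) (by positivity), inv_div]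
  refine le_trans (le_of_eq ?_) h
  ring

lemma momentOrder_le_max_log (hk : 1 ≤ k) (h0 : 0 < β) (h1 : β < 1) :
    (momentOrder β k : ℝ) ≤ 8 * max 1 (Real.log (k / β)) := by
  have h := momentOrder_le hk h0 h1
  have h2 : Real.logb 2 (k / β) ≤ 2 * Real.log (k / β) := by
    rw [Real.logb, div_le_iff₀ (Real.log_pos (by norm_num))]
    nlinarith [Real.log_two_gt_d9, Real.log_pos (one_lt_div hk h0 h1)]
  linarith [le_max_left 1 (Real.log (k / β)), le_max_right 1 (Real.log (k / β))]

/-- The summand √m·n² of T suffices for the analysis; the other two are nonnegative and dropped. -/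
lemma projDim_ge (hn : 1 ≤ n) (hm : 1 ≤ m) (hk : 1 ≤ k) (h0 : 0 < β) (h1 : β < 1) :
    16384 * (2 + Real.logb 2 (k / β)) * (√(m : ℝ) * (n : ℝ) ^ 2) ≤ projDim n β m k := by
  refine le_trans ?_ (Nat.le_ceil _)
  have e : Real.logb 2 (1 / tau β k) = 2 + Real.logb 2 (k / β) := by
    have e := logb_two_pow_mul 2 hk h0 h1
    push_cast at e
    rw [← e, tau, one_div_div]
    congr 1
    ring
  rw [e]
  have hl := logb_div_pos hk h0 h1
  have : 0 ≤ (m : ℝ) ^ (3 / 2 : ℝ) / 2 + (n : ℝ) ^ 4 / (2 * √(m : ℝ)) := by positivity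
  norm_num
  refine mul_le_mul_of_nonneg_left ?_ (by positivity)
  linarith

lemma one_le_sqrt_cast (hm : 1 ≤ m) : 1 ≤ √(m : ℝ) :=
  Real.one_le_sqrt.2 (by exact_mod_cast hm)

lemma mul_le_projDim (hn : 1 ≤ n) (hm : 1 ≤ m) (hk : 1 ≤ k) (h0 : 0 < β) (h1 : β < 1) :
    32768 * (√(m : ℝ) * (n : ℝ) ^ 2) ≤ projDim n β m k := by
  refine le_trans ?_ (projDim_ge hn hm hk h0 h1)
  gcongr
  linarith [logb_div_pos hk h0 h1]

lemma one_le_sqrt_mul_sq (hn : 1 ≤ n) (hm : 1 ≤ m) : 1 ≤ √(m : ℝ) * (n : ℝ) ^ 2 :=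
  one_le_mul_of_one_le_of_one_le (one_le_sqrt_cast hm) (one_le_pow₀ (by exact_mod_cast hn))

lemma eight_mul_momentOrder_le (hn : 1 ≤ n) (hm : 1 ≤ m) (hk : 1 ≤ k) (h0 : 0 < β) (h1 : β < 1) :
    8 * momentOrder β k ≤ projDim n β m k := by
  have h2 := projDim_ge hn hm hk h0 h1
  have h3 := one_le_sqrt_mul_sq hn hm
  have h4 := momentOrder_le hk h0 h1
  have h5 := logb_div_pos hk h0 h1
  have h6 : (8 : ℝ) * momentOrder β k ≤ projDim n β m k := by nlinarith
  exact_mod_cast h6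

lemma momentOrder_mul_two_le (hn : 1 ≤ n) (hm : 1 ≤ m) (hk : 1 ≤ k) (h0 : 0 < β) (h1 : β < 1) :
    momentOrder β k * 2 ≤ indepDegree (projDim n β m k) β k := by
  have hk' : (0 : ℝ) < k := by exact_mod_cast hk
  have hT : (128 : ℝ) ≤ projDim n β m k := by
    linarith [mul_le_projDim hn hm hk h0 h1, one_le_sqrt_mul_sq hn hm]
  -- The constant 6 in `momentOrder_le` is absorbed by T/2 ≥ 64.
  have h2 : Real.logb 2 (2 ^ 6 * (k / β)) ≤ Real.logb 2 (k * projDim n β m k / (2 * β)) := by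
    refine Real.logb_le_logb_of_le (by norm_num) (by positivity) ?_
    rw [← mul_div_assoc, div_le_div_iff₀ h0 (by positivity)]
    nlinarith [mul_pos hk' h0]
  rw [logb_two_pow_mul 6 hk h0 h1] at h2
  have h3 := Nat.le_ceil (2 * Real.logb 2 (k * projDim n β m k / (2 * β)))
  have h4 := momentOrder_le hk h0 h1
  have h5 : (momentOrder β k : ℝ) * 2 ≤ indepDegree (projDim n β m k) β k := by
    rw [indepDegree]
    push_cast at h2
    linarith
  exact_mod_cast h5

lemma sigma_pos {ε δ : ℝ} (hε : 0 < ε) (hδ0 : 0 < δ) (hδ1 : δ < 1) : 0 < sigma ε δ := by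
  have : 0 < Real.log (1 / δ) := Real.log_pos (by rw [lt_div_iff₀ hδ0]; linarith)
  rw [sigma]
  positivity

/-- The two error terms are below the error bound. -/
lemma error_terms_le {ε δ : ℝ} (hn : 1 ≤ n) (hm : 1 ≤ m) (hk : 1 ≤ k) (hε0 : 0 < ε)
    (hε1 : ε < 1) (h0 : 0 < β) (h1 : β < 1) :
    1 / n * (2 * momentOrder β k * √(m : ℝ) + momentOrder β k * (8 * √(m : ℝ) / sigma ε δ)) ≤
      errorBound 500 n ε δ β m k := by
  have hn' : (1 : ℝ) ≤ n := by exact_mod_cast hn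
  have hm' : (1 : ℝ) ≤ m := by exact_mod_cast hm
  set p : ℝ := ((momentOrder β k : ℕ) : ℝ)
  set M := max 1 (Real.log (1 / δ))
  set ℓ := max 1 (Real.log (k / β)) with hℓ
  have hℓ1 : 1 ≤ ℓ := le_max_left _ _
  have hM : 1 ≤ M := le_max_left _ _
  have hp : p ≤ 8 * ℓ := momentOrder_le_max_log hk h0 h1
  have hp0 : 0 ≤ p := Nat.cast_nonneg _
  -- The logarithm serves only as a positive constant: 208 ≤ 500·0.69.
  have hlog : 0.69 ≤ Real.log (m + n) := by
    have : Real.log 2 ≤ Real.log (m + n) := Real.log_le_log (by norm_num) (by linarith)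
    linarith [Real.log_two_gt_d9]
  have h8 : √(8 * Real.log (1 / δ)) ≤ 3 * √M := by
    rw [show (3 : ℝ) = √(3 ^ 2) by rw [Real.sqrt_sq (by norm_num)],
      ← Real.sqrt_mul (by norm_num)]
    refine Real.sqrt_le_sqrt ?_
    linarith [le_max_right 1 (Real.log (1 / δ))]
  have hsM : 1 ≤ √M := Real.one_le_sqrt.2 hM
  have hm0 := Real.sqrt_nonneg (m : ℝ)
  rw [errorBound, Real.sqrt_mul (Nat.cast_nonneg m), sigma]
  have e1 : 8 * √(m : ℝ) / (ε / √(8 * Real.log (1 / δ))) =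
      8 * √(m : ℝ) * √(8 * Real.log (1 / δ)) / ε := by rw [div_div_eq_mul_div]
  rw [e1]
  have h9 : 8 * √(m : ℝ) * √(8 * Real.log (1 / δ)) / ε ≤ 24 * (√(m : ℝ) * √M) / ε := by
    refine div_le_div_of_nonneg_right ?_ hε0.le
    nlinarith
  have h10 : √(m : ℝ) ≤ √(m : ℝ) * √M / ε := by
    rw [le_div_iff₀ hε0]
    gcongr
    linarith
  set B := √(m : ℝ) * √M / ε with hB
  have hB0 : 0 ≤ B := by positivity
  calc 1 / (n : ℝ) * (2 * p * √(m : ℝ) + p * (8 * √(m : ℝ) * √(8 * Real.log (1 / δ)) / ε))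
      ≤ 1 / n * (2 * p * B + p * (24 * B)) := by
        gcongr
        rw [hB, ← mul_div_assoc]
        exact h9
    _ = 1 / n * (26 * p * B) := by ring
    _ ≤ 1 / n * (26 * (8 * ℓ) * B) := by gcongr
    _ = 1 / n * (208 * (ℓ * B)) := by ring
    _ ≤ 1 / n * (500 * Real.log (m + n) * (ℓ * B)) := by
        gcongr
        linarith
    _ = _ := by
        rw [hB]
        field_simp
        rfl

end Parameters

/-! ### Failure probability of one query, and the union bound -/

section Accuracy

variable {X : Type*} [Fintype X] (e : X ≃ Fin (Fintype.card X))

lemma measurable_projVec {T : ℕ} (a : X → ℝ) (i : Fin T) :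
    Measurable fun f : HashFn T (Fintype.card X) => projVec e f a i :=
  Measurable.of_discrete

lemma exp_neg_natCast_le (p : ℕ) : Real.exp (-p) ≤ (1 / 2) ^ p := by
  rw [Real.exp_neg, ← Real.exp_one_pow, one_div, inv_pow]
  have : (2 : ℝ) ≤ Real.exp 1 := by linarith [Real.exp_one_gt_d9]
  gcongr

open Classical in
/-- Evaluation of a fixed sparse query fails with probability at most `β / k`. -/
lemma measure_error_gt_le {n m k : ℕ} (hn : 1 ≤ n) (hm : 1 ≤ m) (hk : 1 ≤ k) {ε δ β : ℝ}
    (hε0 : 0 < ε) (hε1 : ε < 1) (hδ0 : 0 < δ) (hδ1 : δ < 1) (h0 : 0 < β) (h1 : β < 1)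
    {H : PMF (HashFn (projDim n β m k) (Fintype.card X))}
    (hH : IsWiseIndependent (indepDegree (projDim n β m k) β k) H)
    {Q : LinearQuery X} (hQ : IsSparse m Q) (D : Sym X n) :
    (H.toMeasure.prod (Measure.pi fun _ : Fin (projDim n β m k) => laplace (1 / sigma ε δ))).real
      {q | errorBound 500 n ε δ β m k < |queryValue Q D -
        evalQuery e n Q (fun i => projDatabase e q.1 D i + q.2 i, q.1)|} ≤ β / k := by
  have hk' : (0 : ℝ) < k := by exact_mod_cast hk
  have hn' : (1 : ℝ) ≤ n := by exact_mod_cast hn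
  have hm' : (0 : ℝ) < m := by exact_mod_cast hm
  have hsm := one_le_sqrt_cast hm
  have hsm0 : 0 < √(m : ℝ) := by linarith
  have hσ := sigma_pos hε0 hδ0 hδ1
  have hb : 0 < 1 / sigma ε δ := by positivity
  have := isProbabilityMeasure_laplace hb
  set p := momentOrder β k
  have hp0 : 0 < p := momentOrder_pos hk h0 h1
  have hpe : Even p := even_momentOrder β k
  have hpT : 8 * p ≤ (projDim n β m k) := eight_mul_momentOrder_le hn hm hk h0 h1
  have hT : 0 < (projDim n β m k) := by omega
  have hr := momentOrder_mul_two_le hn hm hk h0 h1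
  set a : X → ℝ := fun x => (Q x : ℝ)
  set c : X → ℝ := fun x => (occ D x : ℝ)
  set ν := Measure.pi fun _ : Fin (projDim n β m k) => laplace (1 / sigma ε δ)
  -- With w = m^(1/4) and l = 1/w, the condition on T reads 32768·√m·n² ≤ T, which holds, while the
  -- distortion 2pw stays below 2p√m.
  set w := √√(m : ℝ) with hw
  have hw2 : w ^ 2 = √(m : ℝ) := Real.sq_sqrt (Real.sqrt_nonneg _)
  have hw1 : 1 ≤ w := Real.one_le_sqrt.2 hsm
  have hwm : w ≤ √(m : ℝ) := by nlinarith
  have hTm := mul_le_projDim hn hm hk h0 h1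
  have hA := measure_inner_sub_ge_le e hT hH (l := 1 / w) hsm0 (by linarith : (0 : ℝ) < n)
    (sum_sq_le_of_isSparse hQ) (sum_occ_sq_le D) (by positivity) (by
      have : 1 / w * (√(m : ℝ) * n) = w * n := by rw [← hw2]; field_simp
      rw [this]
      have : w * n ≤ √(m : ℝ) * (n : ℝ) ^ 2 := by gcongr; nlinarith
      have h : 0 ≤ √(m : ℝ) * (n : ℝ) ^ 2 := by positivity
      linarith) (by
      have : 1 / w * (√(m : ℝ) * n) = w * n := by rw [← hw2]; field_simp
      rw [this, mul_pow, hw2]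
      exact hTm) hpe hp0 hr
  have hB := measure_norm_sq_ge_le e hT hH hsm0 (sum_sq_le_of_isSparse hQ) hpe hp0 hr hpT
  rw [Real.sq_sqrt hm'.le] at hB
  set u : ℝ := p * (8 * √(m : ℝ) / sigma ε δ)
  set A : Set (HashFn (projDim n β m k) (Fintype.card X)) :=
    {f | 2 * p / (1 / w) ≤ |∑ i, projVec e f a i * projVec e f c i - ∑ x, a x * c x|}
  set B : Set (HashFn (projDim n β m k) (Fintype.card X)) := {f | 16 * (m : ℝ) ≤ ∑ i, projVec e f a i ^ 2}
  -- Including the norm bound in the event makes the noise estimate valid on every section: for f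
  -- with large norm the section is empty.
  let E : Set (HashFn (projDim n β m k) (Fintype.card X) × (Fin (projDim n β m k) → ℝ)) :=
    {q | ∑ i, projVec e q.1 a i ^ 2 ≤ 16 * (m : ℝ) ∧ u ≤ |∑ i, projVec e q.1 a i * q.2 i|}
  have hmeas : ∀ i, Measurable fun q : HashFn (projDim n β m k) (Fintype.card X) × (Fin (projDim n β m k) → ℝ) =>
      projVec e q.1 a i := fun i => (measurable_projVec e a i).comp measurable_fst
  have hEm : MeasurableSet E := by
    have m1 : Measurable fun q : HashFn (projDim n β m k) (Fintype.card X) × (Fin (projDim n β m k) → ℝ) =>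
        ∑ i, projVec e q.1 a i ^ 2 :=
      Finset.measurable_sum _ fun i _ => (hmeas i).pow_const 2
    have m2 : Measurable fun q : HashFn (projDim n β m k) (Fintype.card X) × (Fin (projDim n β m k) → ℝ) =>
        |∑ i, projVec e q.1 a i * q.2 i| :=
      (Finset.measurable_sum _ fun i _ => (hmeas i).mul
        ((measurable_pi_apply i).comp measurable_snd)).abs
    exact (measurableSet_le m1 measurable_const).inter (measurableSet_le measurable_const m2)
  have hE : (H.toMeasure.prod ν).real E ≤ 4 * (1 / 2) ^ p := by
    refine ENNReal.toReal_le_of_le_ofReal (by positivity) ?_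
    rw [Measure.prod_apply hEm]
    calc ∫⁻ f, ν (Prod.mk f ⁻¹' E) ∂H.toMeasure
        ≤ ∫⁻ _, ENNReal.ofReal (4 * (1 / 2) ^ p) ∂H.toMeasure := by
          refine lintegral_mono fun f => ?_
          by_cases hf : ∑ i, projVec e f a i ^ 2 ≤ 16 * (m : ℝ)
          -- This l makes l²·16m/σ² equal to 1/4, the largest value allowed, and l·u = p.
          · have h := measure_le_abs_sum_laplace_le (l := sigma ε δ / (8 * √(m : ℝ))) (u := u) hb
              (by positivity) (projVec e f a) hf (le_of_eq (by
                rw [div_pow, mul_pow, Real.sq_sqrt hm'.le]; field_simp; norm_num))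
            have hlu : sigma ε δ / (8 * √(m : ℝ)) * u = p := by
              simp only [u]; field_simp
            rw [hlu] at h
            refine (measure_mono (t := {x | u ≤ |∑ i, projVec e f a i * x i|})
              fun x hx => hx.2).trans ?_
            rw [← ofReal_measureReal]
            exact ENNReal.ofReal_le_ofReal (h.trans (by gcongr; exact exp_neg_natCast_le p))
          · have : Prod.mk f ⁻¹' E = ∅ := by
              ext x
              simp only [E, Set.mem_preimage, Set.mem_ofPred_eq, Set.mem_empty_iff_false, iff_false]
              exact fun h => hf h.1
            simp [this]
      _ = _ := by simp
  have hsub : {q : HashFn (projDim n β m k) (Fintype.card X) × (Fin (projDim n β m k) → ℝ) | errorBound 500 n ε δ β m k <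
      |queryValue Q D - evalQuery e n Q (fun i => projDatabase e q.1 D i + q.2 i, q.1)|} ⊆
      (A ×ˢ Set.univ ∪ B ×ˢ Set.univ) ∪ E := by
    intro q hq
    by_contra hcon
    simp only [Set.mem_union, Set.mem_prod, Set.mem_univ, and_true, not_or, A, B, E,
      Set.mem_ofPred_eq, not_le, not_and] at hcon
    obtain ⟨⟨hqA, hqB⟩, hqE⟩ := hcon
    have hqE := hqE hqB.le
    refine absurd hq (not_lt.2 (le_trans ?_ (error_terms_le (δ := δ) hn hm hk hε0 hε1 h0 h1)))
    have heq : queryValue Q D -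
        evalQuery e n Q (fun i => projDatabase e q.1 D i + q.2 i, q.1) =
        1 / n * -((∑ i, projVec e q.1 a i * projVec e q.1 c i - ∑ x, a x * c x) +
          ∑ i, projVec e q.1 a i * q.2 i) := by
      simp only [queryValue_eq_sum, evalQuery, projQuery_eq_projVec, projDatabase_eq_projVec,
        mul_add, Finset.sum_add_distrib]
      ring
    rw [heq, abs_mul, abs_neg, abs_of_nonneg (by positivity : (0 : ℝ) ≤ 1 / n)]
    refine mul_le_mul_of_nonneg_left ((abs_add_le _ _).trans (add_le_add ?_ hqE.le))
      (by positivity)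
    refine hqA.le.trans ?_
    rw [div_div_eq_mul_div, div_one]
    gcongr
  have hprod : ∀ S : Set (HashFn (projDim n β m k) (Fintype.card X)),
      (H.toMeasure.prod ν).real (S ×ˢ Set.univ) = H.toMeasure.real S := by
    intro S
    rw [measureReal_prod_prod, probReal_univ, mul_one]
  have h5 := (measureReal_mono (μ := H.toMeasure.prod ν) hsub).trans (measureReal_union_le _ _)
  have h6 := measureReal_union_le (μ := H.toMeasure.prod ν) (A ×ˢ Set.univ) (B ×ˢ Set.univ)
  rw [hprod, hprod] at h6
  -- The three events cost (4 + 1 + 4)·2^(-p) ≤ 9β/(16k).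
  have h7 := half_pow_momentOrder_le hk h0 h1
  have h8 : β / (16 * k) = β / k / 16 := by field_simp
  have h9 : 0 < β / k := by positivity
  rw [h8] at h7
  linarith

lemma measurable_evalQuery (n : ℕ) {T : ℕ} (Q : LinearQuery X) :
    Measurable (evalQuery e n Q : ProjData T (Fintype.card X) → ℝ) := by
  unfold evalQuery
  simp_rw [projQuery_eq_projVec]
  refine Measurable.const_mul (Finset.measurable_sum _ fun i _ => ?_) _
  exact ((measurable_projVec e _ i).comp measurable_snd).mul
    ((measurable_pi_apply i).comp measurable_fst)

lemma measurable_sparseProject_output {n T : ℕ} (D : Sym X n) :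
    Measurable fun q : HashFn T (Fintype.card X) × (Fin T → ℝ) =>
      ((fun i => projDatabase e q.1 D i + q.2 i, q.1) : ProjData T (Fintype.card X)) := by
  refine Measurable.prodMk (measurable_pi_lambda _ fun i => ?_) measurable_fst
  simp_rw [projDatabase_eq_projVec]
  exact ((measurable_projVec e _ i).comp measurable_fst).add
    ((measurable_pi_apply i).comp measurable_snd)

/-- A union bound over at most k queries, each failing with probability at most β/k. Finiteness of
the class also makes the good event measurable, so that the output law can be evaluated on it. -/
lemma isAccurateWith_sparseProject {n m k : ℕ} (hn : 1 ≤ n) (hm : 1 ≤ m) (hk : 1 ≤ k)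
    {ε δ β : ℝ} (hε0 : 0 < ε) (hε1 : ε < 1) (hδ0 : 0 < δ) (hδ1 : δ < 1) (h0 : 0 < β) (h1 : β < 1)
    {H : PMF (HashFn (projDim n β m k) (Fintype.card X))}
    (hH : IsWiseIndependent (indepDegree (projDim n β m k) β k) H)
    {𝒬 : Set (LinearQuery X)} (hfin : 𝒬.Finite) (hcard : 𝒬.ncard ≤ k)
    (hsparse : ∀ Q ∈ 𝒬, IsSparse m Q) :
    IsAccurateWith (evalQuery e n) (sparseProject e n ε δ β m k H) 𝒬
      (errorBound 500 n ε δ β m k) β := by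
  intro D
  have hk' : (0 : ℝ) < k := by exact_mod_cast hk
  have := isProbabilityMeasure_laplace (one_div_pos.2 (sigma_pos hε0 hδ0 hδ1))
  set G : Set (ProjData (projDim n β m k) (Fintype.card X)) :=
    {d | ∀ Q ∈ 𝒬, |queryValue Q D - evalQuery e n Q d| ≤ errorBound 500 n ε δ β m k}
  have hG : MeasurableSet G := by
    have : G = ⋂ Q ∈ 𝒬, {d | |queryValue Q D - evalQuery e n Q d| ≤
        errorBound 500 n ε δ β m k} := by
      ext d; simp [G]
    rw [this]
    exact hfin.measurableSet_biInter fun Q _ => measurableSet_le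
      ((measurable_const.sub (measurable_evalQuery e n Q)).abs) measurable_const
  rw [sparseProject, Measure.map_apply (measurable_sparseProject_output e D) hG]
  set P := H.toMeasure.prod
    (Measure.pi fun _ : Fin (projDim n β m k) => laplace (1 / sigma ε δ))
  set out := fun q : HashFn (projDim n β m k) (Fintype.card X) × (Fin (projDim n β m k) → ℝ) =>
      ((fun i => projDatabase e q.1 D i + q.2 i, q.1) : ProjData _ (Fintype.card X))
  have hout : MeasurableSet (out ⁻¹' G) := measurable_sparseProject_output e D hG
  have hbad : P.real (out ⁻¹' G)ᶜ ≤ β := by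
    have hsub : (out ⁻¹' G)ᶜ ⊆ ⋃ Q ∈ hfin.toFinset, {q | errorBound 500 n ε δ β m k <
        |queryValue Q D - evalQuery e n Q (out q)|} := by
      intro q hq
      simp only [G, Set.mem_compl_iff, Set.mem_preimage, Set.mem_ofPred_eq, not_forall,
        not_le] at hq
      obtain ⟨Q, hQ, h⟩ := hq
      simp only [Set.mem_iUnion]
      exact ⟨Q, hfin.mem_toFinset.2 hQ, h⟩
    calc P.real (out ⁻¹' G)ᶜ ≤ P.real (⋃ Q ∈ hfin.toFinset, {q | errorBound 500 n ε δ β m k <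
          |queryValue Q D - evalQuery e n Q (out q)|}) := measureReal_mono hsub (measure_ne_top _ _)
      _ ≤ ∑ Q ∈ hfin.toFinset, P.real {q | errorBound 500 n ε δ β m k <
          |queryValue Q D - evalQuery e n Q (out q)|} := measureReal_biUnion_finset_le _ _
      _ ≤ ∑ _Q ∈ hfin.toFinset, β / k := Finset.sum_le_sum fun Q hQ =>
          measure_error_gt_le e hn hm hk hε0 hε1 hδ0 hδ1 h0 h1 hH
            (hsparse Q (hfin.mem_toFinset.1 hQ)) D
      _ = 𝒬.ncard * (β / k) := by
          rw [Finset.sum_const, nsmul_eq_mul, Set.ncard_eq_toFinset_card _ hfin]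
      _ ≤ k * (β / k) := by gcongr
      _ = β := by field_simp
  rw [probReal_compl_eq_one_sub hout] at hbad
  rw [← ofReal_measureReal]
  exact ENNReal.ofReal_le_ofReal (by linarith)

end Accuracy

end SparseProj

theorem mainTheorem2 :
    ∃ C : ℝ, 0 < C ∧
      ∀ (X : Type*) [Fintype X] (e : X ≃ Fin (Fintype.card X))
        (n m k : ℕ), 1 ≤ n → 1 ≤ m → 1 ≤ k →
      ∀ ε δ β : ℝ, 0 < ε → ε < 1 → 0 < δ → δ < 1 → 0 < β → β < 1 →
      ∀ H : PMF (SparseProj.HashFn (SparseProj.projDim n β m k) (Fintype.card X)),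
        SparseProj.IsWiseIndependent
          (SparseProj.indepDegree (SparseProj.projDim n β m k) β k) H →
      ∀ 𝒬 : Set (SparseProj.LinearQuery X), 𝒬.Finite → 𝒬.ncard ≤ k →
        (∀ Q ∈ 𝒬, SparseProj.IsSparse m Q) →
        SparseProj.IsAccurate (SparseProj.sparseProject e n ε δ β m k H) 𝒬
          (SparseProj.errorBound C n ε δ β m k) β ∧
        SparseProj.IsAccurateWith (SparseProj.evalQuery e n)
          (SparseProj.sparseProject e n ε δ β m k H) 𝒬
          (SparseProj.errorBound C n ε δ β m k) β := by
  refine ⟨500, by norm_num, ?_⟩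
  intro X _ e n m k hn hm hk ε δ β hε0 hε1 hδ0 hδ1 hβ0 hβ1 H hH 𝒬 hfin hcard hsparse
  have h := SparseProj.isAccurateWith_sparseProject e hn hm hk hε0 hε1 hδ0 hδ1 hβ0 hβ1 hH hfin hcard hsparse
  exact ⟨⟨_, h⟩, h⟩
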